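/- Let $G=(V,E)$ be a finite simple graph. For $u\in V$ let $X_u$ and $Z_u$ be the Pauli $X$ and $Z$ operators acting on the qubit $u$ of a register of qubits indexed by $V$ (so they are complex $2^{|V|}\times 2^{|V|}$ matrices), and put $H_m=\sum_{u\in V}X_u$ and $H_p=\sum_{(u,v)\in E}Z_uZ_v$. The QAOA-MaxCut dynamical Lie algebra (DLA) $\mathfrak g_G$ is the real Lie algebra of matrices (with the commutator as bracket) generated by $\{\mathrm i H_p,\mathrm i H_m\}$, and the multi-angle DLA $\mathfrak g_{G,\mathrm{ma}}$ is the one generated by $\{\mathrm i X_u : u\in V\}\cup\{\mathrm i Z_uZ_v : (u,v)\in E\}$. The DLA of $G$ is called free if $\mathfrak g_G=\mathfrak g_{G,\mathrm{ma}}$. The DLA of $G$ is free in each of the following cases. (i) $G$ is an asymmetric subdivision of an odd graph. Here an odd graph is a finite simple connected graph on at least $3$ vertices all of whose degrees are odd. A subdivision of a graph $H$ is obtained by choosing a set $\hat E\subseteq E(H)$ and replacing each edge $(u,v)\in\hat E$ by a path from $u$ to $v$ with $\ell_{uv}\ge 1$ new interior vertices; it is asymmetric if $|E(H)\setminus\hat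 E|\le 1$ and the numbers $\ell_{uv}$, $(u,v)\in\hat E$, are pairwise distinct. (ii) $G=G_{n,1}$ or $G=G_{n,2}$ with $n\ge 3$, where the extended ladder graph $G_{n,k}$ has the $2n+k$ vertices $u_{-k},\dots,u_{n-1},v_0,\dots,v_{n-1}$ and the edges $(u_i,v_i)$ for $0\le i\le n-1$, $(u_i,u_{i+1})$ for $-k\le i\le n-2$, and $(v_i,v_{i+1})$ for $0\le i\le n-2$. (iii) $G=G(w,h)$ with $w>h\ge 3$, where the grid+1 graph $G(w,h)$ has the vertices $u_{i,j}$ for $0\le i\le w$, $0\le j\le h$, and one more vertex $u_{-1,0}$, and the edges $(u_{-1,0},u_{0,0})$, $(u_{i,j},u_{i+1,j})$ for $0\le i\le w-1$, $0\le j\le h$, and $(u_{i,j},u_{i,j+1})$ for $0\le i\le w$, $0\le j\le h-1$. -/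

import Mathlib

namespace QAOA

noncomputable section

/-- Operators on the qubit register indexed by `V`: complex matrices whose rows and columns are
indexed by the computational basis states `V → Fin 2`. -/
abbrev Operator (V : Type*) : Type _ := Matrix (V → Fin 2) (V → Fin 2) ℂ

/-- The Pauli matrix `X` of a single qubit. -/
def pauliX : Matrix (Fin 2) (Fin 2) ℂ := !![0, 1; 1, 0]

/-- The Pauli matrix `Z` of a single qubit. -/
def pauliZ : Matrix (Fin 2) (Fin 2) ℂ := !![1, 0; 0, -1]

/-! The Lie bracket of operators is the commutator `⁅A, B⁆ = A * B - B * A`. -/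

attribute [local instance 100] LieRing.ofAssociativeRing

variable {V : Type*} [Fintype V] [DecidableEq V]

/-- The tensor product over all qubits with factor `P` at the qubit `u` and the identity at all
other qubits; the entries of a tensor product are the products of the entries of the factors. -/
def onQubit (P : Matrix (Fin 2) (Fin 2) ℂ) (u : V) : Operator V :=
  Matrix.of fun x y => ∏ v, (if v = u then P else 1) (x v) (y v)

/-- The Pauli operator `X_u`. -/
def X (u : V) : Operator V := onQubit pauliX u

/-- The Pauli operator `Z_u`. -/
def Z (u : V) : Operator V := onQubit pauliZ u

theorem Z_eq_diagonal (u : V) :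
    (Z u : Operator V) = Matrix.diagonal fun x => pauliZ (x u) (x u) := by
  ext x y
  by_cases hxy : x = y
  · subst hxy
    rw [Matrix.diagonal_apply_eq, Z, onQubit, Matrix.of_apply, Finset.prod_eq_single u]
    · simp
    · intro v _ hv
      simp [hv]
    · simp
  · rw [Matrix.diagonal_apply_ne _ hxy, Z, onQubit, Matrix.of_apply]
    obtain ⟨v, hv⟩ := Function.ne_iff.mp hxy
    refine Finset.prod_eq_zero (Finset.mem_univ v) ?_
    by_cases hvu : v = u
    · rw [if_pos hvu]
      generalize x v = a at hv
      generalize y v = b at hv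
      fin_cases a <;> fin_cases b <;> simp_all [pauliZ]
    · rw [if_neg hvu, Matrix.one_apply_ne hv]

theorem Z_mul_comm (u v : V) : (Z u * Z v : Operator V) = Z v * Z u := by
  simp only [Z_eq_diagonal, Matrix.diagonal_mul_diagonal, mul_comm]

/-- The operator `Z_u Z_v` of an unordered pair `{u, v}`. -/
def ZZ (e : Sym2 V) : Operator V :=
  Sym2.lift ⟨fun u v => Z u * Z v, Z_mul_comm⟩ e

/-- The mixer Hamiltonian `H_m = ∑_{u ∈ V} X_u`. -/
def mixerHamiltonian (V : Type*) [Fintype V] [DecidableEq V] : Operator V := ∑ u, X u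

open Classical in
/-- The problem Hamiltonian `H_p = ∑_{(u,v) ∈ E} Z_u Z_v`, one summand for each edge. -/
def problemHamiltonian (G : SimpleGraph V) : Operator V := ∑ e ∈ G.edgeFinset, ZZ e

/-- The standard QAOA-MaxCut dynamical Lie algebra: the real Lie algebra of matrices, with the
commutator as bracket, generated by `i H_p` and `i H_m`. -/
def dla (G : SimpleGraph V) : LieSubalgebra ℝ (Operator V) :=
  LieSubalgebra.lieSpan ℝ (Operator V)
    {Complex.I • problemHamiltonian G, Complex.I • mixerHamiltonian V}

/-- The multi-angle QAOA-MaxCut dynamical Lie algebra: the real Lie algebra of matrices generated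
by all `i X_u`, `u ∈ V`, and all `i Z_u Z_v`, `(u, v) ∈ E`. -/
def multiAngleDLA (G : SimpleGraph V) : LieSubalgebra ℝ (Operator V) :=
  LieSubalgebra.lieSpan ℝ (Operator V)
    ({A | ∃ u : V, A = Complex.I • X u} ∪
      {A | ∃ u v : V, G.Adj u v ∧ A = Complex.I • (Z u * Z v)})

/-- The QAOA-MaxCut DLA of `G` is free: it equals the multi-angle DLA. -/
def IsFree (G : SimpleGraph V) : Prop := dla G = multiAngleDLA G

end

/-! ### Asymmetric subdivisions of odd graphs -/

/-- An odd graph: a connected graph on at least three vertices, all of whose degrees are odd. -/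
def IsOddGraph {W : Type*} [Fintype W] (H : SimpleGraph W) : Prop :=
  H.Connected ∧ 3 ≤ Fintype.card W ∧ ∀ v, Odd (H.neighborSet v).ncard

/-- The data of a subdivision of `H`: for each edge `e` an ordering `(src e, tgt e)` of its two ends
and the number `len e` of new vertices placed on it; `len e = 0` means that `e` is kept. -/
structure Subdivision {W : Type*} (H : SimpleGraph W) where
  src : H.edgeSet → W
  tgt : H.edgeSet → W
  ends : ∀ e, s(src e, tgt e) = (e : Sym2 W)
  len : H.edgeSet → ℕ

namespace Subdivision

variable {W : Type*} {H : SimpleGraph W} (D : Subdivision H)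

/-- The vertices of the subdivided graph: those of `H`, and `len e` new ones on each edge `e`. -/
abbrev Vertex : Type _ := W ⊕ Σ e : H.edgeSet, Fin (D.len e)

/-- The vertices `src e, w_e^1, …, w_e^ℓ, tgt e`, where `ℓ = len e`, of the path that replaces the
edge `e`, numbered by `0, 1, …, ℓ, ℓ + 1`. -/
def pathVertex (e : H.edgeSet) : ℕ → D.Vertex
  | 0 => Sum.inl (D.src e)
  | j + 1 => if h : j < D.len e then Sum.inr ⟨e, ⟨j, h⟩⟩ else Sum.inl (D.tgt e)

/-- The subdivided graph: its edges join consecutive vertices of the paths that replace the edges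
of `H` (if `len e = 0`, this path is the edge `e` itself). -/
def graph : SimpleGraph D.Vertex :=
  SimpleGraph.fromEdgeSet
    {d | ∃ e, ∃ i ≤ D.len e, d = s(D.pathVertex e i, D.pathVertex e (i + 1))}

/-- The set of edges that are really subdivided. -/
def subdivided : Set H.edgeSet := {e | 1 ≤ D.len e}

/-- At most one edge is not subdivided, and distinct subdivided edges receive different numbers of
new vertices. -/
def IsAsymmetric : Prop := (D.subdividedᶜ).encard ≤ 1 ∧ Set.InjOn D.len D.subdivided

end Subdivision

/-- `G` is (isomorphic to) an asymmetric subdivision of `H`. -/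
def IsAsymmetricSubdivision {V W : Type*} (G : SimpleGraph V) (H : SimpleGraph W) : Prop :=
  ∃ D : Subdivision H, D.IsAsymmetric ∧ Nonempty (G ≃g D.graph)

/-! ### Extended ladder graphs and grid+1 graphs -/

/-- The `(n, k)`-extended ladder graph with vertices `u_{-k}, …, u_{n-1}` and `v_0, …, v_{n-1}`.
Here `Sum.inl a` is `u_{a-k}` and `Sum.inr i` is `v_i`. -/
def extendedLadder (n k : ℕ) : SimpleGraph (Fin (n + k) ⊕ Fin n) :=
  SimpleGraph.fromRel fun
    | Sum.inl a, Sum.inl b => (a : ℕ) + 1 = b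
    | Sum.inr i, Sum.inr j => (i : ℕ) + 1 = j
    | Sum.inl a, Sum.inr i => (a : ℕ) = i + k
    | Sum.inr _, Sum.inl _ => False

/-- The `(w, h)`-grid+1 graph. Here `some (i, j)` is the grid vertex `u_{i,j}`, `0 ≤ i ≤ w`,
`0 ≤ j ≤ h`, and `none` is the additional vertex `u_{-1,0}`, which is attached to `u_{0,0}`. -/
def gridPlusOne (w h : ℕ) : SimpleGraph (Option (Fin (w + 1) × Fin (h + 1))) :=
  SimpleGraph.fromRel fun
    | none, some p => p = (0, 0)
    | some p, some q =>
        ((p.1 : ℕ) + 1 = q.1 ∧ p.2 = q.2) ∨ (p.1 = q.1 ∧ (p.2 : ℕ) + 1 = q.2)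
    | _, none => False

end QAOA

/-!
A polynomial in `ad A`, for `A` in the DLA, maps the DLA to itself, so the eigenspaces of `ad A` can
be separated inside the DLA. For `A = i ∑_{u ∈ P} X_u` this restricts a sum of couplings `i Z_u Z_v`
to the edges that leave `P`. For a sum of couplings `A = i ∑_{uv ∈ S} Z_u Z_v` it restricts
`i ∑_{u ∈ P} X_u` to the vertices of odd degree in `S`: `A` is diagonal, and flipping the qubit `u`
changes its eigenvalue by twice a sum of `deg_S u` signs. Therefore a finest partition of `V` into
classes `P` with `i ∑_{u ∈ P} X_u` in the DLA is parity-equitable: the vertices of a class have the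
same number, modulo 2, of neighbours in each class. Every set obtained from `V` by differences and
by passing to the vertices with an odd number of neighbours in a set is a union of such classes, so
the DLA is free as soon as all singletons can be obtained in this way.

Taking odd neighbours repeatedly moves a set through the graph. In ladders and grids the vertices of
exceptional degree provide sets that sweep the graph and isolate a first singleton. In a subdivision
of an odd graph the old vertices are the start: the sweeps from the two ends of a path meet after a
number of steps that reveals its length, so that asymmetry separates the edges. The other singletons
follow, since a neighbour of `v` is determined by `v` and the remaining neighbours of `v`.
-/

namespace QAOA

section Operators

attribute [local instance 100] LieRing.ofAssociativeRing

theorem aeval_ad_mem {R L : Type*} [CommRing R] [LieRing L] [LieAlgebra R L]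
    {g : LieSubalgebra R L} {x y : L} (hx : x ∈ g) (hy : y ∈ g) (p : Polynomial R) :
    Polynomial.aeval (LieAlgebra.ad R L x) p y ∈ g := by
  induction p using Polynomial.induction_on' with
  | add p q hp hq => simpa using g.add_mem hp hq
  | monomial n a =>
    have hpow : ∀ n : ℕ, (LieAlgebra.ad R L x ^ n) y ∈ g := fun n => by
      induction n with
      | zero => simpa using hy
      | succ n ih => simpa [pow_succ'] using g.lie_mem hx ih
    simpa [Polynomial.aeval_monomial] using g.smul_mem a (hpow n)

theorem finsum_inter_mem_of_aeval_ad {R L ι : Type*} [CommRing R] [LieRing L] [LieAlgebra R L]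
    [Finite ι] {g : LieSubalgebra R L} {x : L} (hx : x ∈ g) {f : ι → L} {s t : Set ι}
    (hs : ∑ᶠ i ∈ s, f i ∈ g) (p : Polynomial R)
    (hp : ∀ i ∈ s, Polynomial.aeval (LieAlgebra.ad R L x) p (f i) = t.indicator f i) :
    ∑ᶠ i ∈ s ∩ t, f i ∈ g := by
  convert aeval_ad_mem hx hs p using 1
  calc ∑ᶠ i ∈ s ∩ t, f i = ∑ᶠ i ∈ s, t.indicator f i := by
        simp only [finsum_mem_def, Set.indicator_indicator]
    _ = ∑ᶠ i ∈ s, Polynomial.aeval (LieAlgebra.ad R L x) p (f i) :=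
        (finsum_mem_congr rfl hp).symm
    _ = Polynomial.aeval (LieAlgebra.ad R L x) p (∑ᶠ i ∈ s, f i) :=
        ((Polynomial.aeval (LieAlgebra.ad R L x) p).toAddMonoidHom.map_finsum_mem f
          s.toFinite).symm

theorem lie_mul_eq_lie_mul_add_mul_lie {R : Type*} [Ring R] (a b c : R) :
    ⁅a, b * c⁆ = ⁅a, b⁆ * c + b * ⁅a, c⁆ := by
  simp only [Ring.lie_def]
  noncomm_ring

section Leibniz

variable {K A : Type*} [CommRing K] [Ring A] [Algebra K A] {a b c : A} {k : K}

theorem lie_lie_mul_of_lie_eq_zero (hb : ⁅a, ⁅a, b⁆⁆ = k • b) (hc : ⁅a, c⁆ = 0) :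
    ⁅a, ⁅a, b * c⁆⁆ = k • (b * c) := by
  simp only [lie_mul_eq_lie_mul_add_mul_lie, hc, hb, mul_zero, add_zero, smul_mul_assoc]

theorem lie_lie_lie_lie_mul (hb : ⁅a, ⁅a, b⁆⁆ = k • b) (hc : ⁅a, ⁅a, c⁆⁆ = k • c) :
    ⁅a, ⁅a, ⁅a, ⁅a, b * c⁆⁆⁆⁆ = (4 * k) • ⁅a, ⁅a, b * c⁆⁆ := by
  simp only [lie_mul_eq_lie_mul_add_mul_lie, lie_add, hb, hc, smul_mul_assoc, mul_smul_comm,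
    lie_smul (R := K) (L := A) (M := A)]
  module

end Leibniz

/-- The computational basis state obtained from `x` by flipping the qubit `u`. -/
def bitFlip {V : Type*} [DecidableEq V] (u : V) (x : V → Fin 2) : V → Fin 2 :=
  Function.update x u (x u + 1)

theorem bitFlip_bitFlip {V : Type*} [DecidableEq V] (u : V) (x : V → Fin 2) :
    bitFlip u (bitFlip u x) = x := by
  have h : ∀ b : Fin 2, b + 1 + 1 = b := by decide
  simp [bitFlip, h]

theorem bitFlip_comm {V : Type*} [DecidableEq V] (u v : V) (x : V → Fin 2) :
    bitFlip u (bitFlip v x) = bitFlip v (bitFlip u x) := by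
  obtain rfl | huv := eq_or_ne u v
  · rfl
  · simp [bitFlip, huv, huv.symm, Function.update_comm huv]

variable {V : Type*} [Fintype V] [DecidableEq V]

theorem X_apply (u : V) (x y : V → Fin 2) : X u x y = if y = bitFlip u x then 1 else 0 := by
  have hflip : ∀ a b : Fin 2, pauliX a b = if b = a + 1 then 1 else 0 := by
    intro a b
    fin_cases a <;> fin_cases b <;> simp [pauliX]
  have hfactor : ∀ v, (if v = u then pauliX else 1) (x v) (y v) =
      if y v = bitFlip u x v then 1 else 0 := by
    intro v
    obtain rfl | hv := eq_or_ne v u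
    · simp [hflip, bitFlip]
    · simp [hv, bitFlip, Matrix.one_apply, eq_comm]
  simp only [X, onQubit, Matrix.of_apply, hfactor, Finset.prod_boole, Finset.mem_univ,
    forall_const, funext_iff]

theorem X_mul_apply (u : V) (A : Operator V) (x y : V → Fin 2) :
    (X u * A) x y = A (bitFlip u x) y := by
  simp [Matrix.mul_apply, X_apply]

theorem X_mul_self (u : V) : X u * X u = (1 : Operator V) := by
  ext x y
  simp only [X_mul_apply, X_apply, bitFlip_bitFlip, Matrix.one_apply, eq_comm]

theorem X_commute (u v : V) : Commute (X u : Operator V) (X v) := by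
  ext x y
  simp only [X_mul_apply, X_apply, bitFlip_comm u v]

theorem X_mul_diagonal (u : V) (d : (V → Fin 2) → ℂ) :
    X u * Matrix.diagonal d = Matrix.diagonal (fun x => d (bitFlip u x)) * X u := by
  ext x y
  simp only [X_mul_apply, Matrix.diagonal_mul, Matrix.diagonal_apply, X_apply]
  grind

/-- The eigenvalue of `Z` at a computational basis state of a qubit. -/
def zSign (b : Fin 2) : ℤ := if b = 0 then 1 else -1

theorem zSign_add_one (b : Fin 2) : zSign (b + 1) = -zSign b := by
  decide +revert

theorem Z_eq_diagonal_zSign (u : V) :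
    (Z u : Operator V) = Matrix.diagonal fun x => (zSign (x u) : ℂ) := by
  have hz : ∀ b, pauliZ b b = (zSign b : ℂ) := by
    intro b
    fin_cases b <;> simp [pauliZ, zSign]
  simp only [Z_eq_diagonal, hz]

theorem Z_mul_X (u : V) : (Z u * X u : Operator V) = -(X u * Z u) := by
  simp [Z_eq_diagonal_zSign, X_mul_diagonal, bitFlip, zSign_add_one, ← Matrix.diagonal_neg]

theorem X_commute_Z {u v : V} (h : u ≠ v) : Commute (X u : Operator V) (Z v) := by
  rw [Commute, SemiconjBy, Z_eq_diagonal_zSign, X_mul_diagonal]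
  simp [bitFlip, h.symm]

theorem lie_lie_X_Z (u : V) : ⁅X u, ⁅X u, (Z u : Operator V)⁆⁆ = (4 : ℝ) • Z u := by
  have hcancel : X u * (X u * Z u) = (Z u : Operator V) := by
    rw [← mul_assoc, X_mul_self, one_mul]
  simp only [Ring.lie_def, Z_mul_X, mul_sub, sub_mul, mul_neg, neg_mul, mul_assoc, hcancel]
  module

/-- The generator `i ∑_{u ∈ P} X_u`: the restriction of `i H_m` to the qubits in `P`. -/
noncomputable def mixer (P : Set V) : Operator V := ∑ᶠ u ∈ P, Complex.I • X u

/-- The generator `i ∑_{uv ∈ S} Z_u Z_v`: the restriction of `i H_p` to the pairs in `S`. -/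
noncomputable def coupling (S : Set (Sym2 V)) : Operator V := ∑ᶠ e ∈ S, Complex.I • ZZ e

theorem mixer_singleton (u : V) : mixer {u} = Complex.I • X u := finsum_mem_singleton

theorem coupling_singleton (e : Sym2 V) : coupling {e} = Complex.I • ZZ e := finsum_mem_singleton

theorem mixer_diff_mem {g : LieSubalgebra ℝ (Operator V)} {P Q : Set V} (hP : mixer P ∈ g)
    (hQ : mixer (P ∩ Q) ∈ g) : mixer (P \ Q) ∈ g := by
  rw [mixer, ← finsum_mem_inter_add_sdiff Q (f := fun u => Complex.I • X u) P.toFinite] at hP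
  exact (g.toSubmodule.add_mem_iff_right hQ).mp hP

theorem coupling_diff_mem {g : LieSubalgebra ℝ (Operator V)} {S T : Set (Sym2 V)}
    (hS : coupling S ∈ g) (hT : coupling (S ∩ T) ∈ g) : coupling (S \ T) ∈ g := by
  rw [coupling, ← finsum_mem_inter_add_sdiff T (f := fun e => Complex.I • ZZ e) S.toFinite] at hS
  exact (g.toSubmodule.add_mem_iff_right hT).mp hS

theorem lie_mixer_eq_zero {A : Operator V} {P : Set V} (h : ∀ v ∈ P, Commute (X v) A) :
    ⁅mixer P, A⁆ = 0 :=
  finsum_mem_induction (fun B => ⁅B, A⁆ = 0) (zero_lie A)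
    (fun B C hB hC => by rw [add_lie, hB, hC, add_zero])
    (fun v hv => ((h v hv).smul_left Complex.I).lie_eq)

theorem lie_mixer_of_mem {A : Operator V} {P : Set V} {u : V} (hu : u ∈ P)
    (h : ∀ v ≠ u, Commute (X v) A) : ⁅mixer P, A⁆ = Complex.I • ⁅X u, A⁆ := by
  have hsplit : mixer P = Complex.I • X u + mixer (P \ {u}) := by
    rw [← mixer_singleton]
    exact (finsum_mem_add_sdiff (Set.singleton_subset_iff.mpr hu) P.toFinite).symm
  rw [hsplit, add_lie, lie_mixer_eq_zero fun v hv => h v hv.2, add_zero, smul_lie]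

theorem lie_mixer_Z_of_notMem {P : Set V} {u : V} (hu : u ∉ P) :
    ⁅mixer P, (Z u : Operator V)⁆ = 0 :=
  lie_mixer_eq_zero fun _ hv => X_commute_Z (ne_of_mem_of_not_mem hv hu)

theorem lie_lie_mixer_Z_of_mem {P : Set V} {u : V} (hu : u ∈ P) :
    ⁅mixer P, ⁅mixer P, (Z u : Operator V)⁆⁆ = (-4 : ℝ) • Z u := by
  have hcomm : ∀ v ≠ u, Commute (X v) ⁅X u, (Z u : Operator V)⁆ := fun v hv => by
    rw [Ring.lie_def]
    exact ((X_commute v u).mul_right (X_commute_Z hv)).sub_right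
      ((X_commute_Z hv).mul_right (X_commute v u))
  rw [lie_mixer_of_mem hu fun v hv => X_commute_Z hv, lie_smul, lie_mixer_of_mem hu hcomm,
    lie_lie_X_Z, smul_smul, Complex.I_mul_I]
  module

/-- The pairs with exactly one end in `P`. -/
def cut {V : Type*} (P : Set V) : Set (Sym2 V) := {e | ∃ u ∈ P, ∃ v ∉ P, e = s(u, v)}

theorem mk_mem_cut {V : Type*} {P : Set V} {u v : V} : s(u, v) ∈ cut P ↔ ¬(u ∈ P ↔ v ∈ P) := by
  simp only [cut, Set.mem_ofPred_eq, Sym2.eq_iff]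
  grind

theorem ZZ_mk (u v : V) : ZZ s(u, v) = (Z u * Z v : Operator V) := rfl

theorem lie_lie_mixer_ZZ_of_mem_cut {P : Set V} {e : Sym2 V} (he : e ∈ cut P) :
    ⁅mixer P, ⁅mixer P, ZZ e⁆⁆ = (-4 : ℝ) • ZZ e := by
  obtain ⟨u, hu, v, hv, rfl⟩ := he
  exact lie_lie_mul_of_lie_eq_zero (lie_lie_mixer_Z_of_mem hu) (lie_mixer_Z_of_notMem hv)

theorem lie_lie_lie_lie_mixer_ZZ_of_notMem_cut {P : Set V} {e : Sym2 V} (he : e ∉ cut P) :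
    ⁅mixer P, ⁅mixer P, ⁅mixer P, ⁅mixer P, ZZ e⁆⁆⁆⁆ = (-16 : ℝ) • ⁅mixer P, ⁅mixer P, ZZ e⁆⁆ := by
  induction e with | _ u v
  rw [mk_mem_cut, not_not] at he
  rw [ZZ_mk]
  by_cases hu : u ∈ P
  · rw [lie_lie_lie_lie_mul (lie_lie_mixer_Z_of_mem hu) (lie_lie_mixer_Z_of_mem (he.mp hu))]
    norm_num
  · have hv := he.not.mp hu
    simp [lie_mul_eq_lie_mul_add_mul_lie, lie_mixer_Z_of_notMem hu, lie_mixer_Z_of_notMem hv]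

theorem coupling_inter_cut_mem {g : LieSubalgebra ℝ (Operator V)} {P : Set V} {S : Set (Sym2 V)}
    (hP : mixer P ∈ g) (hS : coupling S ∈ g) : coupling (S ∩ cut P) ∈ g := by
  -- `(ad (mixer P))²` is `-4` on `Z_u Z_v` across the cut, with eigenvalues `0`, `-16` elsewhere.
  let p : Polynomial ℝ :=
    Polynomial.C (-1 / 48) * (Polynomial.X ^ 4 + Polynomial.C 16 * Polynomial.X ^ 2)
  have hp : ∀ A : Operator V, Polynomial.aeval (LieAlgebra.ad ℝ _ (mixer P)) p A =
      (-1 / 48 : ℝ) • (⁅mixer P, ⁅mixer P, ⁅mixer P, ⁅mixer P, A⁆⁆⁆⁆ +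
        (16 : ℝ) • ⁅mixer P, ⁅mixer P, A⁆⁆) := by
    intro A
    simp [p, pow_succ]
  refine finsum_inter_mem_of_aeval_ad hP hS p fun e _ => ?_
  rw [hp]
  by_cases he : e ∈ cut P
  · rw [Set.indicator_of_mem he]
    simp only [lie_smul, lie_lie_mixer_ZZ_of_mem_cut he]
    module
  · rw [Set.indicator_of_notMem he]
    simp only [lie_smul, lie_lie_lie_lie_mixer_ZZ_of_notMem_cut he]
    module

theorem exists_polynomial_aeval_mul_I (s : Finset ℤ) {f : ℤ → ℝ} (hf : f.Even) :
    ∃ p : Polynomial ℝ, ∀ k ∈ s, Polynomial.aeval (k * Complex.I) p = (f k : ℂ) := by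
  let node : ℕ → ℝ := fun n => -(n : ℝ) ^ 2
  have hnode : Set.InjOn node (s.image Int.natAbs) := fun m _ n _ h => by
    simpa [node, pow_left_inj₀] using h
  let q := Lagrange.interpolate (s.image Int.natAbs) node fun n => f n
  refine ⟨q.comp (Polynomial.X ^ 2), fun k hk => ?_⟩
  have hsq : ((k : ℂ) * Complex.I) ^ 2 = algebraMap ℝ ℂ (node k.natAbs) := by
    simp [node, mul_pow, Nat.cast_natAbs]
  have hk' : f (k.natAbs : ℤ) = f k := by
    obtain h | h := Int.natAbs_eq k
    · rw [← h]
    · rw [← hf, ← h]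
  rw [Polynomial.aeval_comp, map_pow, Polynomial.aeval_X, hsq, Polynomial.aeval_algebraMap_apply,
    Polynomial.coe_aeval_eq_eval,
    Lagrange.eval_interpolate_at_node _ hnode (Finset.mem_image_of_mem _ hk), hk']
  rfl

theorem aeval_ad_diagonal_apply {n : Type*} [Fintype n] [DecidableEq n] (d : n → ℂ)
    (p : Polynomial ℝ) (A : Matrix n n ℂ) (i j : n) :
    Polynomial.aeval (LieAlgebra.ad ℝ _ (Matrix.diagonal d)) p A i j =
      Polynomial.aeval (d i - d j) p * A i j := by
  induction p using Polynomial.induction_on' with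
  | add p q hp hq => simp [hp, hq, add_mul]
  | monomial m a =>
    have hpow : (LieAlgebra.ad ℝ _ (Matrix.diagonal d) ^ m) A i j = (d i - d j) ^ m * A i j := by
      induction m with
      | zero => simp
      | succ m ih =>
        simp [pow_succ', Ring.lie_def, ih]
        ring
    simp [Polynomial.aeval_monomial, hpow, mul_assoc]

/-- The eigenvalue of `Z_u Z_v` at a computational basis state. -/
def zzSign {V : Type*} (x : V → Fin 2) (e : Sym2 V) : ℤ :=
  Sym2.lift ⟨fun u v => zSign (x u) * zSign (x v), fun _ _ => mul_comm _ _⟩ e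

theorem zzSign_mk {V : Type*} (x : V → Fin 2) (u v : V) :
    zzSign x s(u, v) = zSign (x u) * zSign (x v) := rfl

theorem odd_zzSign {V : Type*} (x : V → Fin 2) (e : Sym2 V) : Odd (zzSign x e) := by
  have hz : ∀ b, Odd (zSign b) := by decide
  induction e with | _ u v
  exact (hz _).mul (hz _)

theorem zzSign_bitFlip {V : Type*} [DecidableEq V] (u : V) (x : V → Fin 2) {e : Sym2 V}
    (he : ¬e.IsDiag) : zzSign (bitFlip u x) e = if u ∈ e then -zzSign x e else zzSign x e := by
  induction e with | _ a b
  have hab : a ≠ b := he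
  obtain rfl | ha := eq_or_ne u a
  · simp [zzSign_mk, bitFlip, hab.symm, zSign_add_one]
  · obtain rfl | hb := eq_or_ne u b
    · simp [zzSign_mk, bitFlip, hab, zSign_add_one]
    · simp [zzSign_mk, bitFlip, ha, hb, ha.symm, hb.symm]

theorem ZZ_eq_diagonal (e : Sym2 V) :
    (ZZ e : Operator V) = Matrix.diagonal fun x => (zzSign x e : ℂ) := by
  induction e with | _ u v
  simp only [ZZ_mk, Z_eq_diagonal_zSign, Matrix.diagonal_mul_diagonal, zzSign_mk, Int.cast_mul]

/-- The eigenvalue of `∑_{uv ∈ S} Z_u Z_v` at the computational basis state `x`. -/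
noncomputable def energy {V : Type*} (S : Set (Sym2 V)) (x : V → Fin 2) : ℤ :=
  ∑ᶠ e ∈ S, zzSign x e

theorem coupling_eq_diagonal (S : Set (Sym2 V)) :
    coupling S = Matrix.diagonal fun x => (energy S x : ℂ) * Complex.I := by
  classical
  ext x y
  simp only [coupling, energy, finsum_mem_eq_toFinset_sum, Matrix.sum_apply, Matrix.smul_apply,
    ZZ_eq_diagonal, Matrix.diagonal_apply, smul_eq_mul, Int.cast_sum, Finset.sum_mul]
  split_ifs
  · exact Finset.sum_congr rfl fun e _ => mul_comm _ _
  · simp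

theorem odd_finsum_mem_iff_odd_ncard {ι : Type*} {s : Set ι} (hs : s.Finite) {f : ι → ℤ}
    (hf : ∀ i ∈ s, Odd (f i)) : Odd (∑ᶠ i ∈ s, f i) ↔ Odd s.ncard := by
  induction s, hs using Set.Finite.induction_on with
  | empty => simp
  | @insert i s hi hs ih =>
    rw [finsum_mem_insert f hi hs, Set.ncard_insert_of_notMem hi hs, Nat.odd_add_one, Int.odd_add,
      ← ih fun j hj => hf j (Set.mem_insert_of_mem i hj)]
    simp [hf i (Set.mem_insert i s)]

theorem exists_energy_sub_energy_bitFlip {V : Type*} [Finite V] [DecidableEq V]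
    {S : Set (Sym2 V)} (hS : ∀ e ∈ S, ¬e.IsDiag) (u : V) (x : V → Fin 2) :
    ∃ m : ℤ, energy S x - energy S (bitFlip u x) = 2 * m ∧ (Odd m ↔ Odd {e ∈ S | u ∈ e}.ncard) := by
  refine ⟨∑ᶠ e ∈ {e ∈ S | u ∈ e}, zzSign x e, ?_,
    odd_finsum_mem_iff_odd_ncard (Set.toFinite _) fun e _ => odd_zzSign x e⟩
  have hterm : ∀ e ∈ S, zzSign x e - zzSign (bitFlip u x) e =
      {e | u ∈ e}.indicator (fun e => 2 * zzSign x e) e := fun e he => by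
    rw [zzSign_bitFlip u x (hS e he)]
    by_cases hu : u ∈ e <;> simp [hu, two_mul]
  calc energy S x - energy S (bitFlip u x)
      = ∑ᶠ e ∈ S, (zzSign x e - zzSign (bitFlip u x) e) :=
        (finsum_mem_sub_distrib _ _ S.toFinite).symm
    _ = ∑ᶠ e ∈ S, {e | u ∈ e}.indicator (fun e => 2 * zzSign x e) e := finsum_mem_congr rfl hterm
    _ = ∑ᶠ e ∈ {e ∈ S | u ∈ e}, 2 * zzSign x e := by
        simp only [finsum_mem_def, Set.indicator_indicator]
        rfl
    _ = 2 * ∑ᶠ e ∈ {e ∈ S | u ∈ e}, zzSign x e := (mul_finsum_mem _ _).symm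

theorem mixer_inter_odd_mem {g : LieSubalgebra ℝ (Operator V)} {P : Set V} {S : Set (Sym2 V)}
    (hd : ∀ e ∈ S, ¬e.IsDiag) (hP : mixer P ∈ g) (hS : coupling S ∈ g) :
    mixer (P ∩ {u | Odd {e ∈ S | u ∈ e}.ncard}) ∈ g := by
  -- Flipping `u` changes the energy by an odd multiple of `2` exactly when `u` is to be kept.
  let f : ℤ → ℝ := fun k => if k % 4 = 2 then 1 else 0
  have hf : f.Even := fun k => by
    have : -k % 4 = 2 ↔ k % 4 = 2 := by omega
    simp only [f, this]
  obtain ⟨p, hp⟩ := exists_polynomial_aeval_mul_I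
    (Finset.univ.image fun q : (V → Fin 2) × (V → Fin 2) => energy S q.1 - energy S q.2) hf
  refine finsum_inter_mem_of_aeval_ad hS hP p fun u _ => ?_
  ext x y
  rw [coupling_eq_diagonal, aeval_ad_diagonal_apply, ← sub_mul, ← Int.cast_sub,
    hp _ (Finset.mem_image_of_mem _ (Finset.mem_univ (x, y)))]
  obtain rfl | hxy := eq_or_ne y (bitFlip u x)
  · obtain ⟨m, hm, hodd⟩ := exists_energy_sub_energy_bitFlip hd u x
    have hfm : f (2 * m) = if Odd {e ∈ S | u ∈ e}.ncard then 1 else 0 := by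
      simp only [f, ← hodd, Int.odd_iff]
      congr 1
      rw [eq_iff_iff]
      omega
    simp only [hm, hfm, Set.indicator, Set.mem_ofPred_eq]
    split_ifs <;> simp
  · have hX : X u x y = 0 := by rw [X_apply, if_neg hxy]
    by_cases hu : u ∈ {u | Odd {e ∈ S | u ∈ e}.ncard} <;> simp [hu, hX]

end Operators

section ParityDefinable

variable {V : Type*} {G : SimpleGraph V}

/-- The vertices that have an odd number of neighbours in `s`. -/
def oddNeighbors (G : SimpleGraph V) (s : Set V) : Set V := {u | Odd (G.neighborSet u ∩ s).ncard}

/-- The sets of vertices that can be built from the set of all vertices by differences and by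
passing from a set to its odd neighbours. All of them are unions of classes of every
parity-equitable equivalence relation. -/
inductive ParityDefinable (G : SimpleGraph V) : Set V → Prop
  | univ : ParityDefinable G Set.univ
  | diff {s t : Set V} : ParityDefinable G s → ParityDefinable G t → ParityDefinable G (s \ t)
  | oddNeighbors {s : Set V} : ParityDefinable G s → ParityDefinable G (oddNeighbors G s)

/-- A graph is parity-rigid if each of its vertices is parity-definable. -/
def IsParityRigid (G : SimpleGraph V) : Prop := ∀ v, ParityDefinable G {v}

theorem mem_oddNeighbors {s : Set V} {u : V} :
    u ∈ oddNeighbors G s ↔ Odd (G.neighborSet u ∩ s).ncard := Iff.rfl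

theorem oddNeighbors_empty : oddNeighbors G ∅ = ∅ := by
  simp [oddNeighbors]

theorem mem_oddNeighbors_singleton {u v : V} : u ∈ oddNeighbors G {v} ↔ G.Adj u v := by
  by_cases h : G.Adj u v <;> simp [mem_oddNeighbors, h]

theorem mem_oddNeighbors_sdiff [Finite V] {s t : Set V} (hts : t ⊆ s) {u : V} :
    u ∈ oddNeighbors G (s \ t) ↔ (u ∈ oddNeighbors G s ↔ u ∉ oddNeighbors G t) := by
  have hsum := Set.ncard_inter_add_ncard_sdiff_eq_ncard (G.neighborSet u ∩ s) t
  rw [Set.inter_assoc, Set.inter_eq_self_of_subset_right hts, Set.inter_sdiff_assoc] at hsum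
  simp only [mem_oddNeighbors, ← hsum, Nat.odd_add, ← Nat.not_odd_iff_even]
  tauto

/-- A set is saturated if it is a union of equivalence classes. -/
def IsSaturated (r : Setoid V) (s : Set V) : Prop := ∀ ⦃u v⦄, r u v → u ∈ s → v ∈ s

/-- An equivalence relation on the vertices is parity-equitable if equivalent vertices have, up to
parity, the same number of neighbours in each class. -/
def IsParityEquitable (G : SimpleGraph V) (r : Setoid V) : Prop :=
  ∀ a, IsSaturated r (oddNeighbors G {v | r v a})

theorem IsSaturated.sdiff {r : Setoid V} {s t : Set V} (hs : IsSaturated r s)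
    (ht : IsSaturated r t) : IsSaturated r (s \ t) :=
  fun _ _ huv hu => ⟨hs huv hu.1, fun hv => hu.2 (ht (r.symm huv) hv)⟩

theorem isSaturated_class (r : Setoid V) (a : V) : IsSaturated r {v | r v a} :=
  fun _ _ huv hu => r.trans (r.symm huv) hu

theorem IsSaturated.mem_iff_mem {r : Setoid V} {s : Set V} (hs : IsSaturated r s) {u v : V}
    (huv : r u v) : u ∈ s ↔ v ∈ s :=
  ⟨hs huv, hs (r.symm huv)⟩

theorem IsParityEquitable.isSaturated_oddNeighbors [Finite V] {r : Setoid V}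
    (hr : IsParityEquitable G r) {s : Set V} (hs : IsSaturated r s) :
    IsSaturated r (oddNeighbors G s) := by
  induction s using WellFoundedLT.induction with | _ s ih
  obtain rfl | ⟨a, ha⟩ := s.eq_empty_or_nonempty
  · rw [oddNeighbors_empty]
    exact fun _ _ _ hu => hu.elim
  · have hsub : {v | r v a} ⊆ s := fun v hv => hs (r.symm hv) ha
    have hrest := ih (s \ {v | r v a})
      (Set.sdiff_ssubset_left_iff.mpr ⟨a, ha, r.refl a⟩) (hs.sdiff (isSaturated_class r a))
    intro u v huv hu
    have hclass := (hr a).mem_iff_mem huv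
    have hdiff := hrest.mem_iff_mem huv
    rw [mem_oddNeighbors_sdiff hsub, mem_oddNeighbors_sdiff hsub] at hdiff
    tauto

theorem ParityDefinable.isSaturated [Finite V] {r : Setoid V} (hr : IsParityEquitable G r)
    {s : Set V} (hs : ParityDefinable G s) : IsSaturated r s := by
  induction hs with
  | univ => exact fun _ _ _ _ => trivial
  | diff _ _ hs ht => exact hs.sdiff ht
  | oddNeighbors _ hs => exact hr.isSaturated_oddNeighbors hs

end ParityDefinable

section Freeness

attribute [local instance 100] LieRing.ofAssociativeRing

variable {V : Type*} [Fintype V] [DecidableEq V] {G : SimpleGraph V}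

theorem ncard_incident_eq_ncard {V : Type*} (S : Set (Sym2 V)) (u : V) :
    {e ∈ S | u ∈ e}.ncard = {v | s(u, v) ∈ S}.ncard := by
  have himage : {e ∈ S | u ∈ e} = (fun v => s(u, v)) '' {v | s(u, v) ∈ S} := by
    ext e
    constructor
    · rintro ⟨he, x, rfl⟩
      exact ⟨x, he, rfl⟩
    · rintro ⟨x, hx, rfl⟩
      exact ⟨hx, Sym2.mem_mk_left u x⟩
  rw [himage, Set.ncard_image_of_injective _ fun x y h => Sym2.congr_right.mp h]

theorem mixer_inter_oddNeighbors_mem {g : LieSubalgebra ℝ (Operator V)}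
    (hG : coupling G.edgeSet ∈ g) {P Q : Set V} (hP : mixer P ∈ g) (hQ : mixer Q ∈ g)
    (hPQ : P = Q ∨ Disjoint P Q) : mixer (P ∩ oddNeighbors G Q) ∈ g := by
  have hkeep : ∀ S ⊆ G.edgeSet, coupling S ∈ g →
      (∀ u ∈ P, ∀ v, s(u, v) ∈ S ↔ G.Adj u v ∧ v ∈ Q) → mixer (P ∩ oddNeighbors G Q) ∈ g := by
    intro S hSG hS hiff
    convert mixer_inter_odd_mem (fun e he => G.not_isDiag_of_mem_edgeSet (hSG he)) hP hS using 2
    ext u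
    refine and_congr_right fun hu => ?_
    rw [mem_oddNeighbors, Set.mem_ofPred_eq, ncard_incident_eq_ncard]
    simp only [hiff u hu]
    rfl
  obtain rfl | hPQ := hPQ
  · refine hkeep (G.edgeSet \ cut P) Set.sdiff_subset
      (coupling_diff_mem hG (coupling_inter_cut_mem hP hG)) fun u hu v => ?_
    simp [mk_mem_cut, hu]
  · refine hkeep (G.edgeSet ∩ cut P ∩ cut Q) (fun e he => he.1.1)
      (coupling_inter_cut_mem hQ (coupling_inter_cut_mem hP hG)) fun u hu v => ?_
    have huQ := hPQ.notMem_of_mem_left hu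
    have hvP : v ∈ Q → v ∉ P := fun hv => hPQ.notMem_of_mem_right hv
    simp only [Set.mem_inter_iff, SimpleGraph.mem_edgeSet, mk_mem_cut]
    tauto

theorem exists_isParityEquitable_mixer_mem {g : LieSubalgebra ℝ (Operator V)}
    (hG : coupling G.edgeSet ∈ g) (hV : mixer (Set.univ : Set V) ∈ g) :
    ∃ r, IsParityEquitable G r ∧ ∀ a, mixer {v | r v a} ∈ g := by
  have : Finite (Setoid V) := Finite.of_injective (fun r : Setoid V => fun u v => r u v)
    fun r s h => Setoid.ext fun u v => iff_of_eq (congrFun₂ h u v)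
  obtain ⟨r, hr, hmin⟩ := (Set.toFinite {r : Setoid V | ∀ a, mixer {v | r v a} ∈ g}).exists_minimal
    ⟨⊤, fun a => by convert hV; simp [Setoid.top_def]⟩
  refine ⟨r, fun b u v huv => ?_, hr⟩
  let r' : Setoid V := r ⊓ Setoid.ker (· ∈ oddNeighbors G {x | r x b})
  have hr'_iff : ∀ u v, r' u v ↔ r u v ∧
      (u ∈ oddNeighbors G {x | r x b} ↔ v ∈ oddNeighbors G {x | r x b}) := fun u v =>
    Setoid.inf_iff_and.trans (and_congr_right fun _ => Setoid.ker_def.trans eq_iff_iff)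
  have hr' : ∀ a, mixer {v | r' v a} ∈ g := by
    intro a
    have hsplit := mixer_inter_oddNeighbors_mem hG (hr a) (hr b) ?_
    · by_cases ha : a ∈ oddNeighbors G {x | r x b}
      · convert hsplit using 2
        ext u
        simp [hr'_iff, ha]
      · convert mixer_diff_mem (hr a) hsplit using 2
        ext u
        simp [hr'_iff, ha]
    · by_cases hab : r a b
      · exact Or.inl (Set.ext fun v => ⟨fun h => r.trans h hab, fun h => r.trans h (r.symm hab)⟩)
      · exact Or.inr (Set.disjoint_left.mpr fun v hva hvb => hab (r.trans (r.symm hva) hvb))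
  exact ((hr'_iff u v).mp (hmin hr' inf_le_left huv)).2.mp

theorem mixer_mem_of_parityDefinable_singleton {g : LieSubalgebra ℝ (Operator V)}
    (hG : coupling G.edgeSet ∈ g) (hV : mixer (Set.univ : Set V) ∈ g) {u : V}
    (hu : ParityDefinable G {u}) : mixer {u} ∈ g := by
  obtain ⟨r, hr, hmem⟩ := exists_isParityEquitable_mixer_mem hG hV
  convert hmem u using 2
  ext v
  exact ⟨fun hv => by rw [Set.mem_singleton_iff.mp hv]; exact r.refl u,
    fun hv => hu.isSaturated hr (r.symm hv) rfl⟩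

theorem dla_le_multiAngleDLA (G : SimpleGraph V) : dla G ≤ multiAngleDLA G := by
  classical
  rw [dla, LieSubalgebra.lieSpan_le]
  rintro A (rfl | rfl)
  · rw [problemHamiltonian, Finset.smul_sum]
    refine sum_mem fun e he => ?_
    induction e with | _ u v
    exact LieSubalgebra.subset_lieSpan (Or.inr ⟨u, v, by simpa using he, rfl⟩)
  · rw [mixerHamiltonian, Finset.smul_sum]
    exact sum_mem fun u _ => LieSubalgebra.subset_lieSpan (Or.inl ⟨u, rfl⟩)

theorem coupling_edgeSet_mem_dla (G : SimpleGraph V) : coupling G.edgeSet ∈ dla G := by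
  classical
  refine LieSubalgebra.subset_lieSpan (Or.inl ?_)
  rw [problemHamiltonian, Finset.smul_sum, coupling, ← finsum_mem_coe_finset,
    SimpleGraph.coe_edgeFinset]

theorem mixer_univ_mem_dla (G : SimpleGraph V) : mixer Set.univ ∈ dla G := by
  refine LieSubalgebra.subset_lieSpan (Or.inr ?_)
  rw [mixerHamiltonian, Finset.smul_sum, mixer, finsum_mem_univ, finsum_eq_sum_of_fintype]
  rfl

theorem edgeSet_inter_cut_inter_cut {V : Type*} {G : SimpleGraph V} {u v : V} (huv : G.Adj u v) :
    G.edgeSet ∩ cut {u} ∩ cut {v} = {s(u, v)} := by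
  ext e
  induction e with | _ a b
  simp only [Set.mem_inter_iff, SimpleGraph.mem_edgeSet, mk_mem_cut, Set.mem_singleton_iff,
    Sym2.eq_iff]
  grind [huv.ne, huv.symm]

theorem IsParityRigid.isFree (h : IsParityRigid G) : IsFree G := by
  refine le_antisymm (dla_le_multiAngleDLA G) ?_
  have hG := coupling_edgeSet_mem_dla G
  have hX u : mixer {u} ∈ dla G :=
    mixer_mem_of_parityDefinable_singleton hG (mixer_univ_mem_dla G) (h u)
  rw [multiAngleDLA, LieSubalgebra.lieSpan_le]
  rintro A (⟨u, rfl⟩ | ⟨u, v, huv, rfl⟩)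
  · rw [← mixer_singleton]
    exact hX u
  · rw [← ZZ_mk, ← coupling_singleton, ← edgeSet_inter_cut_inter_cut huv]
    exact coupling_inter_cut_mem (hX v) (coupling_inter_cut_mem (hX u) hG)

end Freeness

section ParityDefinableSets

variable {V V' : Type*} {G : SimpleGraph V} {G' : SimpleGraph V'}

namespace ParityDefinable

variable {s t : Set V}

theorem empty : ParityDefinable G ∅ := by
  simpa using (univ (G := G)).diff univ

theorem inter (hs : ParityDefinable G s) (ht : ParityDefinable G t) :
    ParityDefinable G (s ∩ t) := by
  simpa using hs.diff (hs.diff ht)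

theorem union (hs : ParityDefinable G s) (ht : ParityDefinable G t) :
    ParityDefinable G (s ∪ t) := by
  have h := univ.diff ((univ.diff hs).inter (univ.diff ht))
  rwa [← Set.compl_eq_univ_sdiff, ← Set.compl_eq_univ_sdiff, ← Set.compl_eq_univ_sdiff,
    ← Set.compl_union, compl_compl] at h

theorem biUnion {ι : Type*} {I : Set ι} (hI : I.Finite) {f : ι → Set V}
    (hf : ∀ i ∈ I, ParityDefinable G (f i)) : ParityDefinable G (⋃ i ∈ I, f i) := by
  induction I, hI using Set.Finite.induction_on with
  | empty => simpa using empty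
  | insert _ _ ih =>
    rw [Set.biUnion_insert]
    exact (hf _ (Set.mem_insert _ _)).union (ih fun i hi => hf i (Set.mem_insert_of_mem _ hi))

theorem neighborSet {v : V} (hv : ParityDefinable G {v}) : ParityDefinable G (G.neighborSet v) := by
  convert hv.oddNeighbors using 1
  ext u
  rw [mem_oddNeighbors_singleton, SimpleGraph.mem_neighborSet, G.adj_comm]

theorem singleton_of_adj {v x : V} (hfin : (G.neighborSet v).Finite) (hv : ParityDefinable G {v})
    (hx : G.Adj v x) (h : ∀ y, G.Adj v y → y ≠ x → ParityDefinable G {y}) :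
    ParityDefinable G {x} := by
  convert hv.neighborSet.diff (biUnion (hfin.subset Set.sdiff_subset)
    fun y (hy : y ∈ G.neighborSet v \ {x}) => h y hy.1 hy.2) using 1
  ext y
  rw [Set.biUnion_of_singleton, Set.sdiff_sdiff_right_self]
  exact ⟨fun hy => ⟨hy ▸ hx, hy⟩, fun hy => hy.2⟩

end ParityDefinable

theorem preimage_oddNeighbors (f : G ↪g G') (S : Set V') :
    f ⁻¹' oddNeighbors G' (S ∩ Set.range f) = oddNeighbors G (f ⁻¹' S) := by
  ext u
  have himage : f '' (G.neighborSet u ∩ f ⁻¹' S) = G'.neighborSet (f u) ∩ (S ∩ Set.range f) := by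
    ext y
    constructor
    · rintro ⟨v, ⟨huv, hv⟩, rfl⟩
      exact ⟨f.map_adj_iff.mpr huv, hv, v, rfl⟩
    · rintro ⟨huv, hv, v, rfl⟩
      exact ⟨v, ⟨f.map_adj_iff.mp huv, hv⟩, rfl⟩
  rw [Set.mem_preimage, mem_oddNeighbors, mem_oddNeighbors, ← himage,
    Set.ncard_image_of_injective _ f.injective]

theorem ParityDefinable.preimage_iso (f : G ≃g G') {s : Set V'} (hs : ParityDefinable G' s) :
    ParityDefinable G (f ⁻¹' s) := by
  induction hs with
  | univ => exact univ
  | diff _ _ hs ht => exact hs.diff ht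
  | @oddNeighbors s _ hs =>
    rw [← Set.inter_univ s, ← f.surjective.range_eq]
    exact (preimage_oddNeighbors f.toEmbedding s).symm ▸ hs.oddNeighbors

theorem IsParityRigid.of_iso (h : IsParityRigid G') (f : G ≃g G') : IsParityRigid G := fun v => by
  convert (h (f v)).preimage_iso f using 1
  ext u
  simp

theorem odd_ncard_insert_inter {s t : Set V} {a : V} (ha : a ∉ s) (hs : s.Finite) :
    Odd (insert a s ∩ t).ncard ↔ ¬(a ∈ t ↔ Odd (s ∩ t).ncard) := by
  by_cases hat : a ∈ t
  · rw [Set.insert_inter_of_mem hat,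
      Set.odd_card_insert_iff (fun h => ha h.1) (hs.inter_of_left t), ← Nat.not_odd_iff_even]
    tauto
  · rw [Set.insert_inter_of_notMem hat]
    tauto

theorem odd_ncard_singleton_inter {t : Set V} {a : V} : Odd ({a} ∩ t).ncard ↔ a ∈ t := by
  by_cases ha : a ∈ t <;> simp [ha]

theorem odd_ncard_pair_inter {t : Set V} {a b : V} (hab : a ≠ b) :
    Odd ({a, b} ∩ t).ncard ↔ ¬(a ∈ t ↔ b ∈ t) := by
  rw [odd_ncard_insert_inter (by simpa using hab) (Set.finite_singleton b),
    odd_ncard_singleton_inter]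

end ParityDefinableSets

section SquareLattice

/-- The infinite square grid. Ladders and grids are induced subgraphs of it, and odd neighbours
can be computed there without case distinctions at the boundary. -/
noncomputable def squareLattice : SimpleGraph (ℤ × ℤ) := SimpleGraph.hasse ℤ □ SimpleGraph.hasse ℤ

theorem squareLattice_adj {p q : ℤ × ℤ} : squareLattice.Adj p q ↔
    ((p.1 + 1 = q.1 ∨ q.1 + 1 = p.1) ∧ p.2 = q.2) ∨
      ((p.2 + 1 = q.2 ∨ q.2 + 1 = p.2) ∧ p.1 = q.1) := by
  simp only [squareLattice, SimpleGraph.boxProd_adj, SimpleGraph.hasse_adj,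
    Order.covBy_iff_add_one_eq]

theorem neighborSet_squareLattice (x y : ℤ) :
    squareLattice.neighborSet (x, y) = {(x + 1, y), (x - 1, y), (x, y + 1), (x, y - 1)} := by
  ext ⟨a, b⟩
  simp only [SimpleGraph.mem_neighborSet, squareLattice_adj, Set.mem_insert_iff,
    Set.mem_singleton_iff, Prod.mk.injEq]
  omega

theorem finite_neighborSet_squareLattice (p : ℤ × ℤ) : (squareLattice.neighborSet p).Finite := by
  rw [← Prod.eta p, neighborSet_squareLattice]
  exact Set.toFinite _

theorem mem_oddNeighbors_squareLattice {S : Set (ℤ × ℤ)} {x y : ℤ} :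
    (x, y) ∈ oddNeighbors squareLattice S ↔
      ((x + 1, y) ∈ S ↔ ((x - 1, y) ∈ S ↔ ((x, y + 1) ∈ S ↔ (x, y - 1) ∉ S))) := by
  rw [mem_oddNeighbors, neighborSet_squareLattice,
    odd_ncard_insert_inter (by simp; omega) (Set.toFinite _),
    odd_ncard_insert_inter (by simp) (Set.toFinite _), odd_ncard_pair_inter (by simp; omega)]
  tauto

end SquareLattice

section InducedSubgraphs

variable {V : Type*} {G : SimpleGraph V} {R S T : Set V}

/-- The vertices of `R` that belong to `S` form a parity-definable set of the subgraph of `G`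
induced by `R`. Only the part of `S` inside `R` matters. -/
def ParityDefinableOn (G : SimpleGraph V) (R S : Set V) : Prop :=
  ParityDefinable (G.induce R) (Subtype.val ⁻¹' S)

namespace ParityDefinableOn

theorem congr (hS : ParityDefinableOn G R S) (h : ∀ v ∈ R, v ∈ S ↔ v ∈ T) :
    ParityDefinableOn G R T := by
  exact (congrArg (ParityDefinable (G.induce R)) (Set.ext fun v => h v v.2)).mp hS

theorem self : ParityDefinableOn G R R := by
  rw [ParityDefinableOn, Subtype.coe_preimage_self]
  exact .univ

theorem diff (hS : ParityDefinableOn G R S) (hT : ParityDefinableOn G R T) :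
    ParityDefinableOn G R (S \ T) :=
  ParityDefinable.diff hS hT

theorem inter (hS : ParityDefinableOn G R S) (hT : ParityDefinableOn G R T) :
    ParityDefinableOn G R (S ∩ T) :=
  ParityDefinable.inter hS hT

theorem oddNeighbors (hS : ParityDefinableOn G R S) :
    ParityDefinableOn G R (oddNeighbors G (S ∩ R)) := by
  have h := preimage_oddNeighbors (SimpleGraph.Embedding.induce (G := G) R) S
  rw [show Set.range (SimpleGraph.Embedding.induce (G := G) R) = R from Subtype.range_coe] at h
  exact (congrArg (ParityDefinable (G.induce R)) h).mpr (ParityDefinable.oddNeighbors hS)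

theorem iff_singleton {v : V} (hv : v ∈ R) :
    ParityDefinableOn G R {v} ↔ ParityDefinable (G.induce R) {⟨v, hv⟩} := by
  rw [ParityDefinableOn]
  congr!
  ext u
  simp [Subtype.ext_iff]

theorem singleton_of_adj {v x : V} (hfin : (G.neighborSet v).Finite)
    (hv : ParityDefinableOn G R {v}) (hvR : v ∈ R) (hxR : x ∈ R) (hx : G.Adj v x)
    (h : ∀ y ∈ R, G.Adj v y → y ≠ x → ParityDefinableOn G R {y}) :
    ParityDefinableOn G R {x} := by
  rw [iff_singleton hvR] at hv
  rw [iff_singleton hxR]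
  refine hv.singleton_of_adj ?_ hx fun y hvy hy => ?_
  · exact hfin.preimage Subtype.val_injective.injOn
  · exact (iff_singleton y.2).mp (h y y.2 hvy fun h => hy (Subtype.ext h))

end ParityDefinableOn

theorem isParityRigid_induce (h : ∀ v ∈ R, ParityDefinableOn G R {v}) :
    IsParityRigid (G.induce R) :=
  fun v => (ParityDefinableOn.iff_singleton v.2).mp (h v v.2)

end InducedSubgraphs

section Ladder

variable {n k : ℕ}

/-- The vertices `u_i = (i, 0)` and `v_i = (i, 1)` of the extended ladder. -/
def ladderRegion (n k : ℕ) : Set (ℤ × ℤ) :=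
  {p | p.2 = 0 ∧ -k ≤ p.1 ∧ p.1 < n ∨ p.2 = 1 ∧ 0 ≤ p.1 ∧ p.1 < n}

theorem parityDefinableOn_ladder_even (hn : 3 ≤ n) (hk : k = 1 ∨ k = 2) :
    ParityDefinableOn squareLattice (ladderRegion n k)
      {p | p = (0, 1) ∨ p.1 = n - 1 ∨ k = 2 ∧ p = (-1, 0)} := by
  have huniv := (ParityDefinableOn.self (G := squareLattice) (R := ladderRegion n k))
  refine (huniv.diff huniv.oddNeighbors).congr fun ⟨x, y⟩ hR => ?_
  simp only [ladderRegion, Set.mem_sdiff, Set.mem_inter_iff, Set.mem_ofPred_eq,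
    mem_oddNeighbors_squareLattice, Prod.mk.injEq] at hR ⊢
  clear huniv
  grind

theorem parityDefinableOn_ladder_column (hn : 3 ≤ n) (hk : k = 1 ∨ k = 2) (m : ℕ) (hm : m ≤ n) :
    ParityDefinableOn squareLattice (ladderRegion n k) {p | p.1 + m = n} := by
  induction m using Nat.twoStepInduction with
  | zero =>
    refine (ParityDefinableOn.self.diff ParityDefinableOn.self).congr fun ⟨x, y⟩ hR => ?_
    simp only [ladderRegion, Set.mem_sdiff, Set.mem_ofPred_eq] at hR ⊢
    omega
  | one =>
    have hE := parityDefinableOn_ladder_even hn hk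
    refine (hE.inter hE.oddNeighbors).congr fun ⟨x, y⟩ hR => ?_
    simp only [ladderRegion, Set.mem_inter_iff, Set.mem_ofPred_eq, mem_oddNeighbors_squareLattice,
      Prod.mk.injEq] at hR ⊢
    clear hE
    grind
  | more m ih ih' =>
    refine (((ih' (by omega)).oddNeighbors.diff (ih (by omega))).diff (ih' (by omega))).congr
      fun ⟨x, y⟩ hR => ?_
    simp only [ladderRegion, Set.mem_sdiff, Set.mem_inter_iff, Set.mem_ofPred_eq,
      mem_oddNeighbors_squareLattice] at hR ⊢
    clear ih ih'
    grind

theorem parityDefinableOn_ladder_top (hn : 3 ≤ n) (hk : k = 1 ∨ k = 2) (m : ℕ) (hm : m < n) :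
    ParityDefinableOn squareLattice (ladderRegion n k) {((m : ℤ), 1)} := by
  induction m with
  | zero =>
    refine ((parityDefinableOn_ladder_even hn hk).inter
      (parityDefinableOn_ladder_column hn hk n le_rfl)).congr fun ⟨x, y⟩ hR => ?_
    simp only [ladderRegion, Set.mem_inter_iff, Set.mem_ofPred_eq, Set.mem_singleton_iff,
      Prod.mk.injEq] at hR ⊢
    omega
  | succ m ih =>
    refine ((ih (by omega)).oddNeighbors.inter
      (parityDefinableOn_ladder_column hn hk (n - (m + 1)) (by omega))).congr fun ⟨x, y⟩ hR => ?_
    simp only [ladderRegion, Set.mem_inter_iff, Set.mem_ofPred_eq, Set.mem_singleton_iff,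
      mem_oddNeighbors_squareLattice, Prod.mk.injEq] at hR ⊢
    clear ih
    grind

theorem parityDefinableOn_ladder_bottom (hn : 3 ≤ n) (hk : k = 1 ∨ k = 2) (m : ℕ) (hm : m < n) :
    ParityDefinableOn squareLattice (ladderRegion n k) {((m : ℤ), 0)} := by
  refine ((parityDefinableOn_ladder_column hn hk (n - m) (by omega)).diff
    (parityDefinableOn_ladder_top hn hk m hm)).congr fun ⟨x, y⟩ hR => ?_
  simp only [ladderRegion, Set.mem_sdiff, Set.mem_ofPred_eq, Set.mem_singleton_iff,
    Prod.mk.injEq] at hR ⊢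
  omega

theorem parityDefinableOn_ladder_singleton (hn : 3 ≤ n) (hk : k = 1 ∨ k = 2) (j : ℕ)
    {p : ℤ × ℤ} (hp : p ∈ ladderRegion n k) (hj : -j ≤ p.1) :
    ParityDefinableOn squareLattice (ladderRegion n k) {p} := by
  induction j generalizing p with
  | zero =>
    obtain ⟨x, y⟩ := p
    lift x to ℕ using by simpa using hj
    simp only [ladderRegion, Set.mem_ofPred_eq] at hp
    obtain ⟨rfl, _, hx⟩ | ⟨rfl, _, hx⟩ := hp
    · exact parityDefinableOn_ladder_bottom hn hk x (by omega)
    · exact parityDefinableOn_ladder_top hn hk x (by omega)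
  | succ j ih =>
    by_cases hj' : -j ≤ p.1
    · exact ih hp hj'
    have hv : (p.1 + 1, (0 : ℤ)) ∈ ladderRegion n k := by
      simp only [ladderRegion, Set.mem_ofPred_eq, true_and] at hp ⊢
      omega
    refine (ih hv (by omega)).singleton_of_adj (finite_neighborSet_squareLattice _) hv hp ?_
      fun q hq hvq hqp => ih hq ?_
    · simp only [ladderRegion, Set.mem_ofPred_eq] at hp
      rw [squareLattice_adj]
      omega
    · simp only [ladderRegion, Set.mem_ofPred_eq, squareLattice_adj, ne_eq, Prod.ext_iff] at *
      omega

theorem isParityRigid_induce_ladderRegion (hn : 3 ≤ n) (hk : k = 1 ∨ k = 2) :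
    IsParityRigid (squareLattice.induce (ladderRegion n k)) :=
  isParityRigid_induce fun p hp => parityDefinableOn_ladder_singleton hn hk k hp (by
    simp only [ladderRegion, Set.mem_ofPred_eq] at hp
    omega)

/-- The embedding of the extended ladder with `u_i = (i, 0)` and `v_i = (i, 1)`. -/
noncomputable def ladderEmbedding (n k : ℕ) : extendedLadder n k ↪g squareLattice where
  toFun := Sum.elim (fun a => (a - k, 0)) fun i => (i, 1)
  inj' := by
    rintro (a | i) (b | j) h <;>
      simp only [Sum.elim_inl, Sum.elim_inr, Prod.mk.injEq, Sum.inl.injEq, Sum.inr.injEq,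
        reduceCtorEq, Fin.ext_iff] at h ⊢ <;> omega
  map_rel_iff' := by
    rintro (a | i) (b | j) <;> change squareLattice.Adj (_, _) (_, _) ↔ _ <;>
      simp only [squareLattice_adj, extendedLadder, SimpleGraph.fromRel_adj, ne_eq,
        Sum.inl.injEq, Sum.inr.injEq, reduceCtorEq, not_false_eq_true, true_and, and_true, or_false,
        false_or, Fin.ext_iff] <;> omega

theorem range_ladderEmbedding : Set.range (ladderEmbedding n k) = ladderRegion n k := by
  ext ⟨x, y⟩
  constructor
  · rintro ⟨a | i, h⟩
    · obtain ⟨rfl, rfl⟩ := Prod.mk.inj (h : ((a : ℤ) - k, (0 : ℤ)) = (x, y))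
      exact Or.inl ⟨rfl, by dsimp only; omega⟩
    · obtain ⟨rfl, rfl⟩ := Prod.mk.inj (h : ((i : ℤ), (1 : ℤ)) = (x, y))
      exact Or.inr ⟨rfl, by dsimp only; omega⟩
  · rintro (⟨rfl, hx⟩ | ⟨rfl, hx⟩)
    · exact ⟨Sum.inl ⟨(x + k).toNat, by omega⟩,
        Prod.ext (show ((x + k).toNat : ℤ) - k = x by omega) rfl⟩
    · exact ⟨Sum.inr ⟨x.toNat, by omega⟩, Prod.ext (show (x.toNat : ℤ) = x by omega) rfl⟩

theorem isParityRigid_extendedLadder (hn : 3 ≤ n) (hk : k = 1 ∨ k = 2) :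
    IsParityRigid (extendedLadder n k) := by
  have h := isParityRigid_induce_ladderRegion hn hk
  rw [← range_ladderEmbedding] at h
  exact h.of_iso (ladderEmbedding n k).isoInduceRange

end Ladder

section Grid

variable {w h : ℕ}

/-- The vertices `u_{i,j} = (i, j)` and `u_{-1,0} = (-1, 0)` of the grid+1 graph. -/
def gridRegion (w h : ℕ) : Set (ℤ × ℤ) :=
  {p | 0 ≤ p.1 ∧ p.1 ≤ w ∧ 0 ≤ p.2 ∧ p.2 ≤ h ∨ p.1 = -1 ∧ p.2 = 0}

/-- The vertices of odd degree of the grid+1 graph. -/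
def gridBoundary (w h : ℕ) : Set (ℤ × ℤ) :=
  {p | p.2 = 0 ∧ p.1 < w ∨ p.1 = 0 ∧ p.2 < h ∨ p.1 = w ∧ 0 < p.2 ∧ p.2 < h ∨
    p.2 = h ∧ 0 < p.1 ∧ p.1 < w}

theorem parityDefinableOn_gridBoundary (hh : 3 ≤ h) (hw : h < w) :
    ParityDefinableOn squareLattice (gridRegion w h) (gridBoundary w h) := by
  have huniv := ParityDefinableOn.self (G := squareLattice) (R := gridRegion w h)
  refine huniv.oddNeighbors.congr fun ⟨x, y⟩ hR => ?_
  simp only [gridRegion, gridBoundary, Set.mem_inter_iff, Set.mem_ofPred_eq,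
    mem_oddNeighbors_squareLattice] at hR ⊢
  clear huniv
  grind

theorem parityDefinableOn_grid_corners (hh : 3 ≤ h) (hw : h < w) :
    ParityDefinableOn squareLattice (gridRegion w h)
      {p | p.2 = 0 ∧ p.1 ≤ 0 ∨ p.2 = 0 ∧ p.1 = w - 1 ∨ p.1 = 0 ∧ p.2 = h - 1 ∨
        p.2 = h ∧ (p.1 = 1 ∨ p.1 = w - 1) ∨ p.1 = w ∧ (p.2 = 1 ∨ p.2 = h - 1)} := by
  have hB := parityDefinableOn_gridBoundary hh hw
  refine (hB.inter hB.oddNeighbors).congr fun ⟨x, y⟩ hR => ?_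
  simp only [gridRegion, gridBoundary, Set.mem_inter_iff, Set.mem_ofPred_eq,
    mem_oddNeighbors_squareLattice] at hR ⊢
  clear hB
  grind (splits := 20)

theorem parityDefinableOn_grid_pendantEdge (hh : 3 ≤ h) (hw : h < w) :
    ParityDefinableOn squareLattice (gridRegion w h)
      {p | p.2 = 0 ∧ p.1 ≤ 0 ∨ h = 3 ∧ p.1 = w ∧ (p.2 = 1 ∨ p.2 = 2)} := by
  have hC := parityDefinableOn_grid_corners hh hw
  refine (hC.inter hC.oddNeighbors).congr fun ⟨x, y⟩ hR => ?_
  simp only [gridRegion, Set.mem_inter_iff, Set.mem_ofPred_eq,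
    mem_oddNeighbors_squareLattice] at hR ⊢
  clear hC
  grind (splits := 30)

theorem parityDefinableOn_grid_axes (hh : 3 ≤ h) (hw : h < w) (d : ℕ) (hd : d ≤ h) :
    ParityDefinableOn squareLattice (gridRegion w h)
      {p | p.1 = d ∧ p.2 = 0 ∨ p.1 = 0 ∧ p.2 = d ∧ d < h ∨
        d = 0 ∧ (p.1 = -1 ∨ h = 3 ∧ p.1 = w ∧ (p.2 = 1 ∨ p.2 = 2))} := by
  induction d using Nat.twoStepInduction with
  | zero =>
    refine (parityDefinableOn_grid_pendantEdge hh hw).congr fun ⟨x, y⟩ hR => ?_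
    simp only [gridRegion, Set.mem_ofPred_eq, Nat.cast_zero, true_and] at hR ⊢
    omega
  | one =>
    have hB := parityDefinableOn_gridBoundary hh hw
    have hE := parityDefinableOn_grid_pendantEdge hh hw
    refine ((hE.oddNeighbors.inter hB).diff hE).congr fun ⟨x, y⟩ hR => ?_
    simp only [gridRegion, gridBoundary, Set.mem_sdiff, Set.mem_inter_iff, Set.mem_ofPred_eq,
      mem_oddNeighbors_squareLattice] at hR ⊢
    clear hB hE
    grind (splits := 30)
  | more d ih ih' =>
    have hB := parityDefinableOn_gridBoundary hh hw
    refine (((ih' (by omega)).oddNeighbors.inter hB).diff (ih (by omega))).congr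
      fun ⟨x, y⟩ hR => ?_
    simp only [gridRegion, gridBoundary, Set.mem_sdiff, Set.mem_inter_iff, Set.mem_ofPred_eq,
      mem_oddNeighbors_squareLattice] at hR ⊢
    clear ih ih' hB
    grind (splits := 30)

theorem parityDefinableOn_grid_axis (hh : 3 ≤ h) (hw : h < w) (m : ℕ) (hm : m ≤ h) :
    ParityDefinableOn squareLattice (gridRegion w h) {((h : ℤ) - m, 0)} := by
  induction m with
  | zero =>
    refine (parityDefinableOn_grid_axes hh hw h le_rfl).congr fun ⟨x, y⟩ hR => ?_
    simp only [gridRegion, Set.mem_ofPred_eq, Set.mem_singleton_iff, Prod.mk.injEq] at hR ⊢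
    omega
  | succ m ih =>
    refine ((ih (by omega)).oddNeighbors.inter
      (parityDefinableOn_grid_axes hh hw (h - (m + 1)) (by omega))).congr fun ⟨x, y⟩ hR => ?_
    simp only [gridRegion, Set.mem_inter_iff, Set.mem_ofPred_eq, Set.mem_singleton_iff,
      mem_oddNeighbors_squareLattice, Prod.mk.injEq] at hR ⊢
    clear ih
    grind (splits := 30)

theorem parityDefinableOn_grid_pendant (hh : 3 ≤ h) (hw : h < w) :
    ParityDefinableOn squareLattice (gridRegion w h) {(-1, 0)} := by
  have hO := parityDefinableOn_grid_axis hh hw h le_rfl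
  refine (hO.oddNeighbors.inter
    (parityDefinableOn_grid_pendantEdge hh hw)).congr fun ⟨x, y⟩ hR => ?_
  simp only [gridRegion, Set.mem_inter_iff, Set.mem_ofPred_eq, Set.mem_singleton_iff,
    mem_oddNeighbors_squareLattice, Prod.mk.injEq] at hR ⊢
  clear hO
  grind (splits := 30)

theorem parityDefinableOn_grid_triangle (hh : 3 ≤ h) (hw : h < w) (j : ℕ) {p : ℤ × ℤ}
    (hp : p ∈ gridRegion w h) (hph : p.1 + p.2 ≤ h) (hj : p.2 ≤ j) :
    ParityDefinableOn squareLattice (gridRegion w h) {p} := by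
  induction j generalizing p with
  | zero =>
    obtain ⟨x, y⟩ := p
    obtain ⟨hx, -, hy, -⟩ | ⟨rfl, rfl⟩ := hp
    · obtain rfl : y = 0 := le_antisymm (by simpa using hj) hy
      convert parityDefinableOn_grid_axis hh hw (h - x).toNat (by omega) using 3
      omega
    · exact parityDefinableOn_grid_pendant hh hw
  | succ j ih =>
    by_cases hj' : p.2 ≤ j
    · exact ih hp hph hj'
    have hv : (p.1, (j : ℤ)) ∈ gridRegion w h := by
      simp only [gridRegion, Set.mem_ofPred_eq] at hp ⊢
      omega
    refine (ih hv (by omega) le_rfl).singleton_of_adj (finite_neighborSet_squareLattice _) hv hp ?_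
      fun q hq hvq hqp => ih hq ?_ ?_
    · rw [squareLattice_adj]
      omega
    all_goals
      simp only [squareLattice_adj, ne_eq, Prod.ext_iff] at hvq hqp
      omega

theorem parityDefinableOn_grid_singleton (hh : 3 ≤ h) (hw : h < w) (a : ℕ) {p : ℤ × ℤ}
    (hp : p ∈ gridRegion w h) (ha : p.1 ≤ a) :
    ParityDefinableOn squareLattice (gridRegion w h) {p} := by
  induction a generalizing p with
  | zero =>
    refine parityDefinableOn_grid_triangle hh hw h hp ?_ ?_ <;>
    · simp only [gridRegion, Set.mem_ofPred_eq] at hp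
      omega
  | succ a ih =>
    by_cases ha' : p.1 ≤ a
    · exact ih hp ha'
    have hv : ((a : ℤ), p.2) ∈ gridRegion w h := by
      simp only [gridRegion, Set.mem_ofPred_eq] at hp ⊢
      omega
    refine (ih hv le_rfl).singleton_of_adj (finite_neighborSet_squareLattice _) hv hp ?_
      fun q hq hvq hqp => ih hq ?_
    · rw [squareLattice_adj]
      omega
    · simp only [squareLattice_adj, ne_eq, Prod.ext_iff] at hvq hqp
      omega

theorem isParityRigid_induce_gridRegion (hh : 3 ≤ h) (hw : h < w) :
    IsParityRigid (squareLattice.induce (gridRegion w h)) :=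
  isParityRigid_induce fun p hp => parityDefinableOn_grid_singleton hh hw w hp (by
    simp only [gridRegion, Set.mem_ofPred_eq] at hp
    omega)

/-- The embedding of the grid+1 graph with `u_{i,j} = (i, j)` and `u_{-1,0} = (-1, 0)`. -/
noncomputable def gridEmbedding (w h : ℕ) : gridPlusOne w h ↪g squareLattice where
  toFun := fun p => p.elim (-1, 0) fun q => (q.1, q.2)
  inj' := by
    rintro (_ | ⟨i, j⟩) (_ | ⟨i', j'⟩) hpq <;>
      simp only [Option.elim, Prod.mk.injEq, reduceCtorEq, false_and, Option.some.injEq,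
        Fin.ext_iff] at hpq ⊢
    omega
  map_rel_iff' := by
    rintro (_ | ⟨i, j⟩) (_ | ⟨i', j'⟩) <;> change squareLattice.Adj (_, _) (_, _) ↔ _ <;>
      simp only [squareLattice_adj, gridPlusOne, SimpleGraph.fromRel_adj, ne_eq, Option.some.injEq,
        reduceCtorEq, not_false_eq_true, not_true_eq_false, Prod.mk.injEq, Fin.ext_iff,
        Fin.val_zero, true_and, and_true, and_false, or_false, false_or, iff_false] <;>
      omega

theorem range_gridEmbedding : Set.range (gridEmbedding w h) = gridRegion w h := by
  ext ⟨x, y⟩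
  constructor
  · rintro ⟨_ | ⟨i, j⟩, hxy⟩
    · obtain ⟨rfl, rfl⟩ := Prod.mk.inj (hxy : ((-1 : ℤ), (0 : ℤ)) = (x, y))
      exact Or.inr ⟨rfl, rfl⟩
    · obtain ⟨rfl, rfl⟩ := Prod.mk.inj (hxy : ((i : ℤ), (j : ℤ)) = (x, y))
      exact Or.inl (by dsimp only; omega)
  · rintro (⟨hx, hxw, hy, hyh⟩ | ⟨rfl, rfl⟩)
    · exact ⟨some (⟨x.toNat, by dsimp only at *; omega⟩, ⟨y.toNat, by dsimp only at *; omega⟩),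
        Prod.ext (Int.toNat_of_nonneg hx) (Int.toNat_of_nonneg hy)⟩
    · exact ⟨none, rfl⟩

theorem isParityRigid_gridPlusOne (hh : 3 ≤ h) (hw : h < w) : IsParityRigid (gridPlusOne w h) := by
  have hrigid := isParityRigid_induce_gridRegion hh hw
  rw [← range_gridEmbedding] at hrigid
  exact hrigid.of_iso (gridEmbedding w h).isoInduceRange

end Grid

theorem exists_ne_ne_adj_or_adj_of_connected {W : Type*} {H : SimpleGraph W}
    (hH : H.Connected) (hcard : 3 ≤ Nat.card W) (a b : W) :
    ∃ c, c ≠ a ∧ c ≠ b ∧ (H.Adj a c ∨ H.Adj b c) := by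
  have hpair : ({a, b} : Set W) ≠ Set.univ := fun h => by
    have hle := Set.ncard_insert_le a {b}
    rw [h, Set.ncard_univ, Set.ncard_singleton] at hle
    omega
  obtain ⟨x, hx⟩ := (Set.ne_univ_iff_exists_notMem _).mp hpair
  obtain ⟨p⟩ := hH.preconnected a x
  obtain ⟨⟨⟨y, c⟩, hyc⟩, -, hy, hc⟩ := p.exists_boundary_dart {a, b} (Set.mem_insert a {b}) hx
  simp only [Set.mem_insert_iff, Set.mem_singleton_iff, not_or] at hc
  obtain rfl | rfl := hy
  · exact ⟨c, hc.1, hc.2, Or.inl hyc⟩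
  · exact ⟨c, hc.1, hc.2, Or.inr hyc⟩

namespace Subdivision

section Paths

variable {W : Type*} {H : SimpleGraph W} {D : Subdivision H} {e : H.edgeSet} {i : ℕ} {w : W}

theorem src_ne_tgt (D : Subdivision H) (e : H.edgeSet) : D.src e ≠ D.tgt e := by
  have he := e.2
  rw [← D.ends e] at he
  exact (H.mem_edgeSet.mp he).ne

theorem eq_src_or_eq_tgt (D : Subdivision H) (hw : w ∈ (e : Sym2 W)) :
    w = D.src e ∨ w = D.tgt e := by
  rwa [← D.ends e, Sym2.mem_iff] at hw

theorem pathVertex_succ (hi : i < D.len e) : D.pathVertex e (i + 1) = Sum.inr ⟨e, ⟨i, hi⟩⟩ :=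
  dif_pos hi

theorem pathVertex_of_len_lt (hi : D.len e < i) : D.pathVertex e i = Sum.inl (D.tgt e) := by
  obtain _ | i := i
  · omega
  · exact dif_neg (by omega)

theorem pathVertex_eq_inr {e' : H.edgeSet} {j : Fin (D.len e')} :
    D.pathVertex e i = Sum.inr ⟨e', j⟩ ↔ e = e' ∧ i = j + 1 := by
  constructor
  · intro h
    obtain _ | i := i
    · simp [pathVertex] at h
    obtain hi | hi := lt_or_ge i (D.len e)
    · rw [pathVertex_succ hi] at h
      cases h
      exact ⟨rfl, rfl⟩
    · simp [pathVertex_of_len_lt (Nat.lt_succ_of_le hi)] at h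
  · rintro ⟨rfl, rfl⟩
    exact pathVertex_succ j.2

theorem pathVertex_eq_inl :
    D.pathVertex e i = Sum.inl w ↔ i = 0 ∧ D.src e = w ∨ D.len e < i ∧ D.tgt e = w := by
  obtain _ | i := i
  · simp [pathVertex]
  obtain hi | hi := lt_or_ge i (D.len e)
  · simp [pathVertex_succ hi, hi]
  · simp [pathVertex_of_len_lt (Nat.lt_succ_of_le hi), Nat.lt_succ_of_le hi]

theorem pathVertex_injOn (e : H.edgeSet) :
    Set.InjOn (D.pathVertex e) (Set.Iic (D.len e + 1)) := by
  intro i hi i' hi' h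
  rw [Set.mem_Iic] at hi hi'
  have hne := D.src_ne_tgt e
  rcases hx : D.pathVertex e i with w | ⟨e', j⟩
  · obtain ⟨_, rfl⟩ | ⟨_, rfl⟩ := pathVertex_eq_inl.mp hx <;>
      obtain ⟨_, h'⟩ | ⟨_, h'⟩ := pathVertex_eq_inl.mp (h.symm.trans hx) <;>
      first | omega | exact absurd h' hne | exact absurd h'.symm hne
  · rw [(pathVertex_eq_inr.mp hx).2, (pathVertex_eq_inr.mp (h.symm.trans hx)).2]

theorem adj_graph {x y : D.Vertex} : D.graph.Adj x y ↔ ∃ e, ∃ i ≤ D.len e,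
    x = D.pathVertex e i ∧ y = D.pathVertex e (i + 1) ∨
      x = D.pathVertex e (i + 1) ∧ y = D.pathVertex e i := by
  simp only [graph, SimpleGraph.fromEdgeSet_adj, Set.mem_ofPred_eq, Sym2.eq_iff,
    and_iff_left_iff_imp]
  rintro ⟨e, i, hi, ⟨rfl, rfl⟩ | ⟨rfl, rfl⟩⟩ h <;>
    simpa using pathVertex_injOn e (by grind) (by grind) h

theorem adj_pathVertex_succ (hi : i < D.len e) {x : D.Vertex} :
    D.graph.Adj (D.pathVertex e (i + 1)) x ↔ x = D.pathVertex e i ∨ x = D.pathVertex e (i + 2) := by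
  rw [adj_graph]
  constructor
  · rw [pathVertex_succ hi]
    rintro ⟨e', i', -, ⟨h, hx⟩ | ⟨h, hx⟩⟩ <;> obtain ⟨rfl, h⟩ := pathVertex_eq_inr.mp h.symm
    · obtain rfl : i' = i + 1 := h
      exact Or.inr hx
    · obtain rfl : i' = i := by simpa using h
      exact Or.inl hx
  · rintro (rfl | rfl)
    · exact ⟨e, i, hi.le, Or.inr ⟨rfl, rfl⟩⟩
    · exact ⟨e, i + 1, hi, Or.inl ⟨rfl, rfl⟩⟩

theorem pathVertex_succ_mem_oddNeighbors (hi : i < D.len e) {s : Set D.Vertex} :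
    D.pathVertex e (i + 1) ∈ oddNeighbors D.graph s ↔
      ¬(D.pathVertex e i ∈ s ↔ D.pathVertex e (i + 2) ∈ s) := by
  have hne : D.pathVertex e i ≠ D.pathVertex e (i + 2) := fun h => by
    have := pathVertex_injOn e (by grind) (by grind) h
    omega
  rw [mem_oddNeighbors, ← odd_ncard_pair_inter hne]
  congr!
  exact Set.ext fun x => adj_pathVertex_succ hi

open Classical in
/-- The first vertex after `w` on the path that replaces an edge `e` with the end `w`. -/
noncomputable def next (D : Subdivision H) (w : W) (e : H.edgeSet) : D.Vertex :=
  if w = D.src e then D.pathVertex e 1 else D.pathVertex e (D.len e)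

theorem next_src (D : Subdivision H) (e : H.edgeSet) : D.next (D.src e) e = D.pathVertex e 1 :=
  if_pos rfl

theorem next_tgt (D : Subdivision H) (e : H.edgeSet) :
    D.next (D.tgt e) e = D.pathVertex e (D.len e) :=
  if_neg (D.src_ne_tgt e).symm

theorem neighborSet_inl (D : Subdivision H) (w : W) :
    D.graph.neighborSet (Sum.inl w) = D.next w '' {e | w ∈ (e : Sym2 W)} := by
  ext x
  simp only [SimpleGraph.mem_neighborSet, adj_graph, Set.mem_image, Set.mem_ofPred_eq]
  constructor
  · rintro ⟨e, i, hi, ⟨h, rfl⟩ | ⟨h, rfl⟩⟩ <;>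
      obtain ⟨h', rfl⟩ | ⟨h', rfl⟩ := pathVertex_eq_inl.mp h.symm <;> try omega
    · subst h'
      exact ⟨e, D.ends e ▸ Sym2.mem_mk_left _ _, D.next_src e⟩
    · obtain rfl : i = D.len e := by omega
      exact ⟨e, D.ends e ▸ Sym2.mem_mk_right _ _, D.next_tgt e⟩
  · rintro ⟨e, hw, rfl⟩
    obtain rfl | rfl := D.eq_src_or_eq_tgt hw
    · exact ⟨e, 0, Nat.zero_le _, Or.inl ⟨rfl, D.next_src e⟩⟩
    · exact ⟨e, D.len e, le_rfl,
        Or.inr ⟨(pathVertex_of_len_lt (Nat.lt_succ_self _)).symm, D.next_tgt e⟩⟩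

theorem next_eq_inr (w : W) (he : 0 < D.len e) : ∃ j, D.next w e = Sum.inr ⟨e, j⟩ := by
  rw [next]
  split_ifs
  · exact ⟨⟨0, he⟩, pathVertex_succ he⟩
  · exact ⟨⟨D.len e - 1, by omega⟩, pathVertex_eq_inr.mpr ⟨rfl, (Nat.sub_add_cancel he).symm⟩⟩

theorem next_eq_inl (hw : w ∈ (e : Sym2 W)) (he : D.len e = 0) :
    ∃ x, D.next w e = Sum.inl x ∧ (e : Sym2 W) = s(w, x) := by
  obtain rfl | rfl := D.eq_src_or_eq_tgt hw
  · exact ⟨D.tgt e, by rw [next_src, pathVertex_of_len_lt (by omega)], (D.ends e).symm⟩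
  · exact ⟨D.src e, by rw [next_tgt, he]; rfl, by rw [Sym2.eq_swap, D.ends e]⟩

theorem next_injOn (D : Subdivision H) (w : W) : Set.InjOn (D.next w) {e | w ∈ (e : Sym2 W)} := by
  intro e he e' he' h
  obtain hlen | hlen := Nat.eq_zero_or_pos (D.len e) <;>
    obtain hlen' | hlen' := Nat.eq_zero_or_pos (D.len e')
  · obtain ⟨x, hx, hex⟩ := next_eq_inl he hlen
    obtain ⟨x', hx', hex'⟩ := next_eq_inl he' hlen'
    rw [hx, hx', Sum.inl.injEq] at h
    exact Subtype.ext (hex.trans (h ▸ hex'.symm))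
  · obtain ⟨x, hx, -⟩ := next_eq_inl he hlen
    obtain ⟨j, hj⟩ := next_eq_inr w hlen'
    simp [hx, hj] at h
  · obtain ⟨j, hj⟩ := next_eq_inr w hlen
    obtain ⟨x, hx, -⟩ := next_eq_inl he' hlen'
    simp [hx, hj] at h
  · obtain ⟨j, hj⟩ := next_eq_inr w hlen
    obtain ⟨j', hj'⟩ := next_eq_inr w hlen'
    rw [hj, hj'] at h
    cases h
    rfl

theorem ncard_neighborSet_inl (D : Subdivision H) (w : W) :
    (D.graph.neighborSet (Sum.inl w)).ncard = (H.neighborSet w).ncard := by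
  have himage : Subtype.val '' {e : H.edgeSet | w ∈ (e : Sym2 W)} = {e ∈ H.edgeSet | w ∈ e} := by
    ext e
    simp [and_comm]
  rw [D.neighborSet_inl, (D.next_injOn w).ncard_image,
    ← Set.ncard_image_of_injective _ Subtype.val_injective, himage, ncard_incident_eq_ncard]
  rfl

end Paths

section InteriorVertices

variable {W : Type*} {H : SimpleGraph W} {D : Subdivision H} {e : H.edgeSet} {i : ℕ} {w : W}

/-- The set of the new vertices whose edge `e` and position `1, …, len e` on it satisfy `P`. -/
def interiorSet (D : Subdivision H) (P : H.edgeSet → ℕ → Prop) : Set D.Vertex :=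
  {x | ∃ e i, i < D.len e ∧ P e (i + 1) ∧ D.pathVertex e (i + 1) = x}

theorem pathVertex_mem_range_inl : D.pathVertex e i ∈ Set.range Sum.inl ↔ i = 0 ∨ D.len e < i := by
  simp only [Set.mem_range, eq_comm, pathVertex_eq_inl, exists_or, exists_and_left, exists_eq,
    and_true]

theorem pathVertex_mem_interiorSet {P : H.edgeSet → ℕ → Prop} :
    D.pathVertex e i ∈ D.interiorSet P ↔ 0 < i ∧ i ≤ D.len e ∧ P e i := by
  constructor
  · rintro ⟨e', i', hi', hP, h⟩
    rw [pathVertex_succ hi', eq_comm, pathVertex_eq_inr] at h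
    obtain ⟨rfl, rfl⟩ := h
    exact ⟨Nat.succ_pos _, hi', hP⟩
  · rintro ⟨hi, hie, hP⟩
    obtain ⟨i, rfl⟩ := Nat.exists_eq_add_one_of_ne_zero hi.ne'
    exact ⟨e, i, hie, hP, rfl⟩

theorem inl_notMem_interiorSet {P : H.edgeSet → ℕ → Prop} : Sum.inl w ∉ D.interiorSet P := by
  rintro ⟨e, i, hi, -, h⟩
  simp [pathVertex_succ hi] at h

theorem next_mem_range_inl : D.next w e ∈ Set.range Sum.inl ↔ D.len e = 0 := by
  rw [next]
  split_ifs <;> rw [pathVertex_mem_range_inl] <;> omega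

theorem next_mem_interiorSet {P : H.edgeSet → ℕ → Prop} (hP : P e 1 ↔ P e (D.len e)) :
    D.next w e ∈ D.interiorSet P ↔ 0 < D.len e ∧ P e 1 := by
  rw [next]
  split_ifs <;> rw [pathVertex_mem_interiorSet] <;> grind

end InteriorVertices

section ParityDefinableSets

variable {W : Type*} {H : SimpleGraph W} {D : Subdivision H}

theorem parityDefinable_range_inl (hodd : ∀ w, Odd (H.neighborSet w).ncard) :
    ParityDefinable D.graph (Set.range Sum.inl) := by
  convert ParityDefinable.univ.oddNeighbors using 1
  ext x
  rcases x with w | ⟨e, j⟩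
  · simp [mem_oddNeighbors, ncard_neighborSet_inl, hodd w]
  · rw [← pathVertex_succ j.2, pathVertex_mem_range_inl, pathVertex_succ_mem_oddNeighbors j.2]
    simp

theorem parityDefinable_interiorSet {s : Set D.Vertex} {P : H.edgeSet → ℕ → Prop}
    (hs : ParityDefinable D.graph s) (hbase : ParityDefinable D.graph (Set.range Sum.inl))
    (hP : ∀ e i, i < D.len e → (D.pathVertex e (i + 1) ∈ s ↔ P e (i + 1))) :
    ParityDefinable D.graph (D.interiorSet P) := by
  convert hs.diff hbase using 1
  ext x
  rcases x with w | ⟨e, j⟩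
  · simp [inl_notMem_interiorSet]
  · rw [← pathVertex_succ j.2, Set.mem_sdiff, pathVertex_mem_interiorSet, pathVertex_mem_range_inl,
      hP e j j.2]
    grind

theorem parityDefinable_level (hbase : ParityDefinable D.graph (Set.range Sum.inl)) (m : ℕ) :
    ParityDefinable D.graph
      (D.interiorSet fun e i => 2 * (m + 1) ≤ D.len e ∧ (i = m + 1 ∨ i + m = D.len e)) := by
  have h₀ : ParityDefinable D.graph
      (D.interiorSet fun e i => 2 ≤ D.len e ∧ (i = 1 ∨ i = D.len e)) := by
    refine parityDefinable_interiorSet hbase.oddNeighbors hbase fun e i hi => ?_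
    rw [pathVertex_succ_mem_oddNeighbors hi, pathVertex_mem_range_inl, pathVertex_mem_range_inl]
    grind
  induction m using Nat.twoStepInduction with
  | zero => exact h₀
  | one =>
    refine parityDefinable_interiorSet (h₀.oddNeighbors.diff h₀) hbase fun e i hi => ?_
    simp only [Set.mem_sdiff, pathVertex_succ_mem_oddNeighbors hi, pathVertex_mem_interiorSet]
    grind
  | more m ih ih' =>
    refine parityDefinable_interiorSet ((ih'.oddNeighbors.diff ih').diff ih) hbase
      fun e i hi => ?_
    simp only [Set.mem_sdiff, pathVertex_succ_mem_oddNeighbors hi, pathVertex_mem_interiorSet]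
    grind

theorem parityDefinable_middle [Finite W]
    (hbase : ParityDefinable D.graph (Set.range Sum.inl)) :
    ParityDefinable D.graph (D.interiorSet fun e i => 2 * i = D.len e + 1) := by
  obtain ⟨n, hn⟩ := (Set.finite_range D.len).bddAbove
  have hlevels := ParityDefinable.biUnion (Set.finite_Iic n)
    fun m _ => parityDefinable_level hbase m
  refine parityDefinable_interiorSet (ParityDefinable.univ.diff hlevels) hbase fun e i hi => ?_
  have hlen : D.len e ≤ n := hn ⟨e, rfl⟩
  simp only [Set.mem_sdiff, Set.mem_univ, true_and, Set.mem_iUnion, Set.mem_Iic, exists_prop,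
    not_exists, pathVertex_mem_interiorSet]
  constructor
  · intro h
    have h₁ := h i
    have h₂ := h (D.len e - (i + 1))
    omega
  · omega

theorem parityDefinable_level_of_len [Finite W]
    (hbase : ParityDefinable D.graph (Set.range Sum.inl)) (k m : ℕ) :
    ParityDefinable D.graph (D.interiorSet fun e i =>
      D.len e = 2 * (m + 1) + k ∧ (i = m + 1 ∨ i + m = D.len e)) := by
  induction k using Nat.twoStepInduction generalizing m with
  | zero =>
    have h := parityDefinable_level hbase m
    refine parityDefinable_interiorSet (h.inter h.oddNeighbors) hbase fun e i hi => ?_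
    simp only [Set.mem_inter_iff, pathVertex_succ_mem_oddNeighbors hi, pathVertex_mem_interiorSet]
    grind
  | one =>
    refine parityDefinable_interiorSet ((parityDefinable_level hbase m).inter
      (parityDefinable_middle hbase).oddNeighbors) hbase fun e i hi => ?_
    simp only [Set.mem_inter_iff, pathVertex_succ_mem_oddNeighbors hi, pathVertex_mem_interiorSet]
    grind
  | more k ih _ =>
    refine parityDefinable_interiorSet ((parityDefinable_level hbase m).inter
      (ih (m + 1)).oddNeighbors) hbase fun e i hi => ?_
    simp only [Set.mem_inter_iff, pathVertex_succ_mem_oddNeighbors hi, pathVertex_mem_interiorSet]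
    grind

/-- Only the path of the edge `e` has, next to either of its ends, a vertex of `s`. Such a set
tells the neighbour of an old vertex along `e` from its other neighbours. -/
def Isolates (D : Subdivision H) (s : Set D.Vertex) (e : H.edgeSet) : Prop :=
  ∀ w : W, ∀ e' : H.edgeSet, D.next w e' ∈ s ↔ e' = e

theorem IsAsymmetric.eq_of_len_eq (hD : D.IsAsymmetric) {e e' : H.edgeSet}
    (h : D.len e = D.len e') : e = e' := by
  by_cases he : 1 ≤ D.len e
  · exact hD.2 he (h ▸ he : 1 ≤ D.len e') h
  · exact Set.encard_le_one_iff.mp hD.1 e e' he (h ▸ he : ¬1 ≤ D.len e')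

theorem IsAsymmetric.exists_isolates [Finite W] (hD : D.IsAsymmetric)
    (hbase : ParityDefinable D.graph (Set.range Sum.inl)) (e : H.edgeSet) :
    ∃ s, ParityDefinable D.graph s ∧ D.Isolates s e := by
  suffices h : ∃ s, ParityDefinable D.graph s ∧
      ∀ w e', D.next w e' ∈ s ↔ D.len e' = D.len e by
    obtain ⟨s, hs, hlen⟩ := h
    exact ⟨s, hs, fun w e' => (hlen w e').trans ⟨hD.eq_of_len_eq, congrArg D.len⟩⟩
  match _ : D.len e with
  | 0 => exact ⟨_, hbase, fun w e' => next_mem_range_inl⟩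
  | 1 =>
    refine ⟨_, parityDefinable_middle hbase, fun w e' => ?_⟩
    rw [next_mem_interiorSet (by omega)]
    omega
  | k + 2 =>
    refine ⟨_, parityDefinable_level_of_len hbase k 0, fun w e' => ?_⟩
    rw [next_mem_interiorSet (by omega)]
    omega

theorem Isolates.neighborSet_inl_inter {s : Set D.Vertex} {e : H.edgeSet} (hs : D.Isolates s e)
    (w : W) : D.graph.neighborSet (Sum.inl w) ∩ s = {x | w ∈ (e : Sym2 W) ∧ x = D.next w e} := by
  rw [D.neighborSet_inl]
  ext x
  constructor
  · rintro ⟨⟨e', he', rfl⟩, hx⟩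
    obtain rfl := (hs w e').mp hx
    exact ⟨he', rfl⟩
  · rintro ⟨he, rfl⟩
    exact ⟨⟨e, he, rfl⟩, (hs w e).mpr rfl⟩

theorem Isolates.inl_mem_oddNeighbors {s : Set D.Vertex} {e : H.edgeSet} (hs : D.Isolates s e)
    {w : W} : Sum.inl w ∈ oddNeighbors D.graph s ↔ w ∈ (e : Sym2 W) := by
  rw [mem_oddNeighbors, hs.neighborSet_inl_inter]
  by_cases hw : w ∈ (e : Sym2 W) <;> simp [hw]

theorem parityDefinable_ends [Finite W] (hD : D.IsAsymmetric)
    (hbase : ParityDefinable D.graph (Set.range Sum.inl)) (e : H.edgeSet) :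
    ParityDefinable D.graph (Sum.inl '' {w | w ∈ (e : Sym2 W)}) := by
  obtain ⟨s, hs, he⟩ := hD.exists_isolates hbase e
  convert hs.oddNeighbors.inter hbase using 1
  ext x
  rcases x with w | _ <;> simp [he.inl_mem_oddNeighbors]

theorem parityDefinable_next [Finite W] (hD : D.IsAsymmetric)
    (hbase : ParityDefinable D.graph (Set.range Sum.inl)) {w : W} {e : H.edgeSet}
    (hw : w ∈ (e : Sym2 W)) (h : ParityDefinable D.graph {Sum.inl w}) :
    ParityDefinable D.graph {D.next w e} := by
  obtain ⟨s, hs, he⟩ := hD.exists_isolates hbase e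
  convert h.neighborSet.inter hs using 1
  rw [he.neighborSet_inl_inter]
  simp [hw]

theorem parityDefinable_inl (hH : H.Connected) (hcard : 3 ≤ Nat.card W)
    (hends : ∀ e : H.edgeSet, ParityDefinable D.graph (Sum.inl '' {w | w ∈ (e : Sym2 W)})) (w : W) :
    ParityDefinable D.graph {Sum.inl w} := by
  have hpair : ∀ {x y : W}, H.Adj x y → ParityDefinable D.graph (Sum.inl '' {x, y}) := by
    intro x y hxy
    convert hends ⟨s(x, y), hxy⟩
    ext
    simp
  have : Finite W := Nat.finite_of_card_ne_zero (by omega)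
  have : Nontrivial W := Finite.one_lt_card_iff_nontrivial.mp (by omega)
  obtain ⟨b, hwb⟩ := hH.preconnected.exists_adj_of_nontrivial w
  obtain ⟨c, hcw, hcb, hwc | hbc⟩ := exists_ne_ne_adj_or_adj_of_connected hH hcard w b
  · convert (hpair hwb).inter (hpair hwc) using 1
    rw [← Set.image_inter Sum.inl_injective, ← Set.image_singleton]
    congr 1
    grind
  · convert (hpair hwb).diff (hpair hbc) using 1
    rw [← Set.image_sdiff Sum.inl_injective, ← Set.image_singleton]
    congr 1
    have := hwb.ne
    grind

theorem parityDefinable_pathVertex [Finite W] (hD : D.IsAsymmetric)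
    (hbase : ParityDefinable D.graph (Set.range Sum.inl))
    (hinl : ∀ w, ParityDefinable D.graph {Sum.inl w}) (e : H.edgeSet) (i : ℕ)
    (hi : i ≤ D.len e + 1) : ParityDefinable D.graph {D.pathVertex e i} := by
  induction i using Nat.twoStepInduction with
  | zero => exact hinl _
  | one =>
    rw [← D.next_src e]
    exact parityDefinable_next hD hbase (D.ends e ▸ Sym2.mem_mk_left _ _) (hinl _)
  | more i ih ih' =>
    refine (ih' (by omega)).singleton_of_adj (Set.toFinite _)
      ((adj_pathVertex_succ (by omega)).mpr (Or.inr rfl)) fun y hy hne => ?_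
    obtain rfl := ((adj_pathVertex_succ (by omega)).mp hy).resolve_right hne
    exact ih (by omega)

theorem isParityRigid_graph [Fintype W] (hH : IsOddGraph H) (hD : D.IsAsymmetric) :
    IsParityRigid D.graph := by
  obtain ⟨hconn, hcard, hodd⟩ := hH
  rw [← Nat.card_eq_fintype_card] at hcard
  have hbase := parityDefinable_range_inl (D := D) hodd
  have hinl := parityDefinable_inl hconn hcard (parityDefinable_ends hD hbase)
  rintro (w | ⟨e, j⟩)
  · exact hinl w
  · rw [← pathVertex_succ j.2]
    exact parityDefinable_pathVertex hD hbase hinl e (j + 1) (by omega)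

end ParityDefinableSets

end Subdivision

end QAOA

theorem mainTheorem4 :
    (∀ {V W : Type*} [Fintype V] [DecidableEq V] [Fintype W]
        (G : SimpleGraph V) (H : SimpleGraph W),
        QAOA.IsOddGraph H → QAOA.IsAsymmetricSubdivision G H → QAOA.IsFree G) ∧
      (∀ n : ℕ, 3 ≤ n →
        QAOA.IsFree (QAOA.extendedLadder n 1) ∧ QAOA.IsFree (QAOA.extendedLadder n 2)) ∧
      (∀ w h : ℕ, 3 ≤ h → h < w → QAOA.IsFree (QAOA.gridPlusOne w h)) := by
  refine ⟨?_, fun n hn => ⟨?_, ?_⟩, fun w h hh hw => ?_⟩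
  · rintro V W _ _ _ G H hH ⟨D, hD, ⟨φ⟩⟩
    exact ((QAOA.Subdivision.isParityRigid_graph hH hD).of_iso φ).isFree
  · exact (QAOA.isParityRigid_extendedLadder hn (Or.inl rfl)).isFree
  · exact (QAOA.isParityRigid_extendedLadder hn (Or.inr rfl)).isFree
  · exact (QAOA.isParityRigid_gridPlusOne hh hw).isFree
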